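/- Let $d\in\mathbb N$, $T>0$, $\alpha\in(1/4,1]$ and $p=\lfloor 1/\alpha\rfloor$. Let $\mathscr H$ be the Connes--Kreimer Hopf algebra of rooted trees with vertices decorated by $\{0,1,\dots,d\}$ ($0$ is the time letter): the real commutative polynomial algebra in these trees, graded by the number $|\cdot|$ of vertices, with the multiplicative coproduct $\Delta[\tau_1\cdots\tau_n]_a=[\tau_1\cdots\tau_n]_a\otimes\mathbf 1+(\mathrm{id}\otimes[\,\cdot\,]_a)(\Delta\tau_1\cdots\Delta\tau_n)$, where $[F]_a$ is the tree obtained by joining the trees of the forest $F$ to a new root decorated by $a$. For $N\in\mathbb N\cup\{\infty\}$ let $\mathbb B^{(N)}$ be the step-$N$ Butcher group, i.e. the set of linear functionals on $\mathscr H_{\le N}=\mathrm{span}\{\text{forests of degree}\le N\}$ which take the value $1$ at $\mathbf 1$ and are multiplicative on products of forests of total degree at most $N$; it carries the topology of convergence of all coordinates. A level-$N$ ($\alpha$-Hölder) branched rough path is a map $\mathbf Z:[0,T]^2\to\mathbb B^{(N)}$ such that, for all forests $m$ with $|m|\le N$, $\langle \mathbf Z_{st},m\rangle=\langle \mathbf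 Z_{su}\otimes \mathbf Z_{ut},\Delta m\rangle$ for all $s,u,t$, and $|\langle \mathbf Z_{st},m\rangle|\le C_m|t-s|^{\alpha|m|}$ for all $s,t$. For $X\in C^\alpha([0,T];\mathbb R^d)$, a level-$p$ branched rough path $\mathbf Z$ is a lift of the time-extended path $t\mapsto(t,X_t)$ if $\langle \mathbf Z_{st},\bullet_i\rangle=X^i_t-X^i_s$ for $1\le i\le d$, and the integrals against time are the classical ones: $\langle \mathbf Z_{st},[m]_0\rangle=\int_s^t\langle \mathbf Z_{su},m\rangle\,du$ for every forest $m$ with $|m|+1\le p$ (in particular $\langle \mathbf Z_{st},\bullet_0\rangle=t-s$). Let $\mathcal S^{(p)}\subset C([0,T],\mathbb B^{(p)})$ be the set of all continuous paths $(\mathbf Z_{0t})_{t\in[0,T]}$ for such $X$ and such lifts $\mathbf Z$, where $C([0,T],\mathbb B^{(p)})$ carries the topology of uniform convergence. Let $\mathcal H\subset\mathcal S^{(p)}$ be compact and let $f:\mathcal H\to\mathbb R$ be continuous. Then every $x\in\mathcal H$ has a unique branched signature $\mathbf{BSig}(x)$, that is, there is exactly one level-$\infty$ $\alpha$-Hölder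 branched rough path $\mathbf{BSig}(x):[0,T]^2\to\mathbb B^{(\infty)}$ with $\langle\mathbf{BSig}(x)_{0t},m\rangle=\langle x_t,m\rangle$ for all $t\in[0,T]$ and all forests $m$ with $|m|\le p$. Moreover, for every $\varepsilon>0$ there exists $h\in\mathscr H$ such that $$\sup_{x\in\mathcal H}\bigl|f(x)-\langle\mathbf{BSig}(x)_{0T},h\rangle\bigr|<\varepsilon .$$ -/

import Mathlib

open scoped TensorProduct NNReal

noncomputable section

namespace BranchedSig

/-! ### Decorated rooted trees -/

/-- Planar rooted trees with vertices decorated by `A`: a root decoration and a list of branches. -/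
inductive PlanarTree (A : Type*) : Type _
  | node : A → List (PlanarTree A) → PlanarTree A

namespace PlanarTree

variable {A : Type*}

/-- One step of reordering the branches at some vertex of a planar tree. -/
inductive Rel : PlanarTree A → PlanarTree A → Prop
  | perm (a : A) {l l' : List (PlanarTree A)} : l.Perm l' → Rel (node a l) (node a l')
  | congr (a : A) (l₁ l₂ : List (PlanarTree A)) {t t' : PlanarTree A} :
      Rel t t' → Rel (node a (l₁ ++ t :: l₂)) (node a (l₁ ++ t' :: l₂))

/-- The number of vertices. -/
def size : PlanarTree A → ℕ
  | node _ l => 1 + (l.map fun t => size t).sum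

theorem size_node (a : A) (l : List (PlanarTree A)) :
    size (node a l) = 1 + (l.map size).sum := by
  rw [size]

theorem Rel.size_eq {t t' : PlanarTree A} (h : Rel t t') : size t = size t' := by
  induction h with
  | perm a h => rw [size_node, size_node, (h.map size).sum_eq]
  | congr a l₁ l₂ _ ih => simp [size_node, ih]

end PlanarTree

/-- Rooted trees with vertices decorated by `A`, the order of the branches being irrelevant. -/
def Tree (A : Type*) : Type _ := Quot (PlanarTree.Rel (A := A))

namespace Tree

variable {A : Type*}

/-- The rooted tree underlying a planar rooted tree. -/
def mk (t : PlanarTree A) : Tree A := Quot.mk _ t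

/-- A planar representative of a rooted tree. -/
def out (τ : Tree A) : PlanarTree A := Quot.out τ

theorem mk_out (τ : Tree A) : mk τ.out = τ := Quot.out_eq τ

/-- The number of vertices of a rooted tree. -/
def degree (τ : Tree A) : ℕ := Quot.lift PlanarTree.size (fun _ _ h => h.size_eq) τ

/-- The tree `[τ₁ ⋯ τₙ]_a` obtained by joining the trees of a forest to a new root decorated by `a`.
It is computed on planar representatives; see `Tree.graft_mk` for the independence of the choice. -/
def graft (a : A) (F : Multiset (Tree A)) : Tree A :=
  mk (PlanarTree.node a (F.toList.map out))

theorem mk_node_congr (a : A) (l₀ l l' : List (PlanarTree A))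
    (h : List.Forall₂ (fun t t' => mk t = mk t') l l') :
    mk (PlanarTree.node a (l₀ ++ l)) = mk (PlanarTree.node a (l₀ ++ l')) := by
  induction h generalizing l₀ with
  | nil => rfl
  | @cons t t' l l' htt' _ ih =>
    have key : mk (PlanarTree.node a (l₀ ++ t :: l)) = mk (PlanarTree.node a (l₀ ++ t' :: l)) := by
      have hgen := Quot.eqvGen_exact htt'
      clear htt' ih
      induction hgen with
      | rel x y h => exact Quot.sound (PlanarTree.Rel.congr a l₀ l h)
      | refl x => rfl
      | symm x y _ ih => exact ih.symm
      | trans x y z _ _ ih₁ ih₂ => exact ih₁.trans ih₂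
    rw [key]
    simpa using ih (l₀ ++ [t'])

theorem graft_mk (a : A) (l : List (PlanarTree A)) :
    graft a (Multiset.ofList (l.map mk)) = mk (PlanarTree.node a l) := by
  have hout : ∀ L : List (Tree A), (L.map out).map mk = L := by
    intro L
    rw [List.map_map]
    conv_rhs => rw [← List.map_id L]
    exact List.map_congr_left fun τ _ => mk_out τ
  have hperm : ((Multiset.ofList (l.map mk)).toList).Perm (l.map mk) :=
    Multiset.coe_eq_coe.1 (Multiset.coe_toList _)
  have h1 : graft a (Multiset.ofList (l.map mk))
      = mk (PlanarTree.node a ((l.map mk).map out)) :=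
    Quot.sound (PlanarTree.Rel.perm a (hperm.map _))
  rw [h1]
  have h2 := mk_node_congr a [] ((l.map mk).map out) l (by
    rw [← List.forall₂_map_left_iff (f := mk) (R := fun τ t' => τ = mk t'), hout,
      List.forall₂_map_left_iff]
    exact List.forall₂_same.2 fun _ _ => rfl)
  simpa using h2

/-- The tree with a single vertex, decorated by `a`. -/
def single (a : A) : Tree A := graft a 0

end Tree

/-! ### The Connes–Kreimer Hopf algebra -/

/-- The Connes–Kreimer algebra: real polynomials in the decorated rooted trees. -/
abbrev CK (A : Type*) : Type _ := MvPolynomial (Tree A) ℝ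

section CK

variable {A : Type*}

/-- A forest, given by the multiplicities of its trees, as a monomial of the algebra. -/
def forest (m : Tree A →₀ ℕ) : CK A := MvPolynomial.monomial m 1

/-- The total number of vertices of a forest. -/
def forestDegree (m : Tree A →₀ ℕ) : ℕ := m.sum fun τ k => k * τ.degree

/-- The linear map `h ↦ [h]_a` which joins the trees of a forest to a new root decorated by `a`. -/
def graftLin (a : A) : CK A →ₗ[ℝ] CK A :=
  (MvPolynomial.basisMonomials (Tree A) ℝ).constr ℝ
    fun m => MvPolynomial.X (Tree.graft a (Finsupp.toMultiset m))

/-- The coproduct of a tree, by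
`Δ [τ₁ ⋯ τₙ]_a = [τ₁ ⋯ τₙ]_a ⊗ 1 + (id ⊗ [·]_a) (Δ τ₁ ⋯ Δ τₙ)`. -/
def coproductPlanar : PlanarTree A → CK A ⊗[ℝ] CK A
  | PlanarTree.node a l =>
      (MvPolynomial.X (Tree.mk (PlanarTree.node a l)) : CK A) ⊗ₜ[ℝ] (1 : CK A)
        + TensorProduct.map LinearMap.id (graftLin a) (l.map fun t => coproductPlanar t).prod

theorem coproductPlanar_node (a : A) (l : List (PlanarTree A)) :
    coproductPlanar (PlanarTree.node a l) =
      (MvPolynomial.X (Tree.mk (PlanarTree.node a l)) : CK A) ⊗ₜ[ℝ] (1 : CK A)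
        + TensorProduct.map LinearMap.id (graftLin a) (l.map coproductPlanar).prod := by
  rw [coproductPlanar]

theorem coproductPlanar_congr {t t' : PlanarTree A} (h : PlanarTree.Rel t t') :
    coproductPlanar t = coproductPlanar t' := by
  induction h with
  | @perm a l l' h =>
    have e : Tree.mk (PlanarTree.node a l) = Tree.mk (PlanarTree.node a l') :=
      Quot.sound (PlanarTree.Rel.perm a h)
    rw [coproductPlanar_node, coproductPlanar_node, e, (h.map coproductPlanar).prod_eq]
  | @congr a l₁ l₂ t t' h ih =>
    have e : Tree.mk (PlanarTree.node a (l₁ ++ t :: l₂))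
        = Tree.mk (PlanarTree.node a (l₁ ++ t' :: l₂)) :=
      Quot.sound (PlanarTree.Rel.congr a l₁ l₂ h)
    simp only [coproductPlanar_node, e, List.map_append, List.map_cons, ih]

/-- The coproduct of a rooted tree. -/
def coproductTree (τ : Tree A) : CK A ⊗[ℝ] CK A :=
  Quot.lift coproductPlanar (fun _ _ h => coproductPlanar_congr h) τ

/-- The Connes–Kreimer coproduct, the algebra morphism with the given values on trees. -/
def coproduct : CK A →ₐ[ℝ] CK A ⊗[ℝ] CK A := MvPolynomial.aeval coproductTree

/-- The convolution product of linear functionals, `⟨f ⋆ g, h⟩ = ⟨f ⊗ g, Δ h⟩`. -/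
def convolution (f g : CK A →ₗ[ℝ] ℝ) : CK A →ₗ[ℝ] ℝ :=
  LinearMap.mul' ℝ ℝ ∘ₗ TensorProduct.map f g ∘ₗ coproduct.toLinearMap

end CK

/-! ### The (truncated) Butcher group -/

/-- The step-`N` Butcher group: characters of the Connes–Kreimer Hopf algebra truncated at degree
`N`, that is, linear functionals on the span of the forests of degree at most `N` which are
multiplicative as long as the degree does not exceed `N`. Such a functional is recorded by its
extension by zero to the forests of degree larger than `N`. For `N = ⊤` there is no truncation, and
these are the characters of the whole Hopf algebra. -/
@[ext]
structure ButcherGroup (A : Type*) (N : ℕ∞) where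
  /-- the canonical pairing -/
  pair : CK A →ₗ[ℝ] ℝ
  pair_one : pair 1 = 1
  pair_mul : ∀ m n : Tree A →₀ ℕ, ((forestDegree m + forestDegree n : ℕ) : ℕ∞) ≤ N →
    pair (forest m * forest n) = pair (forest m) * pair (forest n)
  pair_eq_zero : ∀ m : Tree A →₀ ℕ, N < (forestDegree m : ℕ∞) → pair (forest m) = 0

/-- The topology of convergence of all coordinates. -/
instance (A : Type*) (N : ℕ∞) : TopologicalSpace (ButcherGroup A N) :=
  TopologicalSpace.induced (fun g (m : Tree A →₀ ℕ) => g.pair (forest m)) inferInstance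

/-! ### Branched rough paths and branched signatures -/

/-- `α`-Hölder branched rough paths of level `N` on `[0, T]`. The character property is part of
`ButcherGroup`; the other two conditions are Chen's relation and the Hölder bounds. -/
structure IsBranchedRoughPath {A : Type*} {N : ℕ∞} {T : ℝ} (α : ℝ≥0)
    (Z : Set.Icc (0 : ℝ) T → Set.Icc (0 : ℝ) T → ButcherGroup A N) : Prop where
  chen : ∀ (s u t : Set.Icc (0 : ℝ) T) (m : Tree A →₀ ℕ), (forestDegree m : ℕ∞) ≤ N →
    (Z s t).pair (forest m) = convolution (Z s u).pair (Z u t).pair (forest m)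
  holder : ∀ m : Tree A →₀ ℕ, (forestDegree m : ℕ∞) ≤ N →
    ∃ C : ℝ, ∀ s t : Set.Icc (0 : ℝ) T,
      |(Z s t).pair (forest m)| ≤ C * |(t : ℝ) - s| ^ ((α : ℝ) * forestDegree m)

/-- `Z` is a level-`N` branched rough path lift of the time-extended path `t ↦ (t, X t)`, over the
alphabet `{0, 1, …, d}` with time letter `0`: it is a branched rough path above that path, and
its integrals against time are the classical ones,
`⟨Z_{st}, [h]_0⟩ = ∫_s^t ⟨Z_{su}, h⟩ du` (for the empty forest `h`, the value is `t - s`). -/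
structure IsTimeExtendedLift {d : ℕ} {N : ℕ∞} {T : ℝ} (hT : 0 < T) (α : ℝ≥0)
    (X : Set.Icc (0 : ℝ) T → EuclideanSpace ℝ (Fin d))
    (Z : Set.Icc (0 : ℝ) T → Set.Icc (0 : ℝ) T → ButcherGroup (Fin (d + 1)) N) : Prop where
  isBranchedRoughPath : IsBranchedRoughPath α Z
  above : ∀ (s t : Set.Icc (0 : ℝ) T) (i : Fin d), 1 ≤ N →
    (Z s t).pair (MvPolynomial.X (Tree.single i.succ)) = X t i - X s i
  time_integral : ∀ (s t : Set.Icc (0 : ℝ) T) (m : Tree (Fin (d + 1)) →₀ ℕ),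
    ((forestDegree m + 1 : ℕ) : ℕ∞) ≤ N →
      (Z s t).pair (graftLin 0 (forest m)) =
        ∫ u in (s : ℝ)..(t : ℝ), (Z s (Set.projIcc 0 T hT.le u)).pair (forest m)

/-- The set of all `(BSig^p(X)_t)_{t ∈ [0, T]}`, where `BSig^p(X)_t = BSig^p(X)_{0t}`, for the
level-`p` branched rough path lifts of time-extended paths with `α`-Hölder spatial part. -/
def liftPaths (d : ℕ) {T : ℝ} (hT : 0 < T) (α : ℝ≥0) (p : ℕ) :
    Set C(Set.Icc (0 : ℝ) T, ButcherGroup (Fin (d + 1)) p) :=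
  {x | ∃ (X : Set.Icc (0 : ℝ) T → EuclideanSpace ℝ (Fin d))
      (Z : Set.Icc (0 : ℝ) T → Set.Icc (0 : ℝ) T → ButcherGroup (Fin (d + 1)) p),
      MemHolder α X ∧ IsTimeExtendedLift hT α X Z ∧
        ∀ t, x t = Z ⟨0, Set.left_mem_Icc.2 hT.le⟩ t}

/-- `B` is the (full) branched signature of the level-`p` branched rough path `x`: the
multiplicative `α`-Hölder extension of `x` to all of the Connes–Kreimer Hopf algebra. -/
structure IsBranchedSignature {d : ℕ} {T : ℝ} (hT : 0 < T) (α : ℝ≥0) {p : ℕ}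
    (x : C(Set.Icc (0 : ℝ) T, ButcherGroup (Fin (d + 1)) p))
    (B : Set.Icc (0 : ℝ) T → Set.Icc (0 : ℝ) T → ButcherGroup (Fin (d + 1)) ⊤) : Prop where
  isBranchedRoughPath : IsBranchedRoughPath α B
  extends_path : ∀ (t : Set.Icc (0 : ℝ) T) (m : Tree (Fin (d + 1)) →₀ ℕ), forestDegree m ≤ p →
    (B ⟨0, Set.left_mem_Icc.2 hT.le⟩ t).pair (forest m) = (x t).pair (forest m)

end BranchedSig

end

/-!
The value of the branched signature at the final time is in general not a continuous function of the
path for the topology of uniform convergence. However, the letter `0` of the alphabet stands for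
time, and for a forest `m` with at most `p` vertices the branched signature `B` of a path `x`
satisfies
`⟨B_{0T}, [m •₀ᵏ]₀⟩ = ∫₀ᵀ ⟨x_v, m⟩ vᵏ dv` (`IsBranchedSignature.pair_moment`).
The right-hand side is continuous in `x`, and the moments of the continuous functions `⟨x, m⟩`
determine `x`. As `B_{0T}` is a character, the continuous functions on `H` of the form
`x ↦ ⟨B_{0T}, h⟩` form an algebra (`signatureAlgebra`), which separates points
(`signatureAlgebra_separatesPoints`), and the Stone–Weierstrass theorem applies.

The branched signature is built degree by degree (`IsRoughUpTo.exists_succ`). Suppose that a rough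
path is known up to degree `n ≥ p`. In degree `n + 1`, Chen's relation prescribes the defect of
additivity of the new coordinate: the pairing with the reduced coproduct, which only involves
degrees up to `n` (`reducedCoproduct_mem`). Coassociativity (`coproduct_coassoc`) makes this defect
a cocycle (`IsRoughUpTo.cocycle`), and it is of order `α (n + 1) > 1`. So the sewing lemma
(`exists_sewing`) yields the new coordinate. It is unique, since two choices differ by an additive
function of order larger than one (`eq_zero_of_additive`).

The same uniqueness argument shows that the integrals against time in the branched signature are the
classical ones also beyond degree `p`, since both sides solve the same Chen relation
(`IsBranchedSignature.pair_graftLin`). The formula for the moments is a special case.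
-/

noncomputable section

namespace BranchedSig

section Algebra

variable {A : Type*}

/-! ### Forests and the coproduct of a grafted forest -/

namespace Tree

theorem mk_surjective : Function.Surjective (mk : PlanarTree A → Tree A) :=
  Quot.mk_surjective

theorem exists_eq_graft (τ : Tree A) : ∃ (a : A) (F : Multiset (Tree A)), τ = graft a F := by
  obtain ⟨⟨a, l⟩, rfl⟩ := mk_surjective τ
  exact ⟨a, _, (graft_mk a l).symm⟩

/-- Every multiset of trees comes from a list of planar trees, so that `graft_mk` applies. -/
theorem exists_map_mk (F : Multiset (Tree A)) :
    ∃ l : List (PlanarTree A), F = Multiset.ofList (l.map mk) := by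
  refine ⟨F.toList.map out, ?_⟩
  have h : (mk ∘ out : Tree A → Tree A) = id := funext mk_out
  rw [List.map_map, h, List.map_id, Multiset.coe_toList]

theorem degree_graft (a : A) (F : Multiset (Tree A)) :
    (graft a F).degree = 1 + (F.map degree).sum := by
  obtain ⟨l, rfl⟩ := exists_map_mk F
  rw [graft_mk, Multiset.map_coe, Multiset.sum_coe, List.map_map]
  exact PlanarTree.size_node a l

theorem degree_pos (τ : Tree A) : 0 < τ.degree := by
  obtain ⟨a, F, rfl⟩ := exists_eq_graft τ
  rw [degree_graft]
  omega

end Tree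

theorem forest_add (m n : Tree A →₀ ℕ) : forest (m + n) = forest m * forest n := by
  simp [forest, MvPolynomial.monomial_mul]

theorem forest_zero : forest (0 : Tree A →₀ ℕ) = 1 := rfl

theorem forest_single (τ : Tree A) : forest (Finsupp.single τ 1) = MvPolynomial.X τ := rfl

theorem forestDegree_add (m n : Tree A →₀ ℕ) :
    forestDegree (m + n) = forestDegree m + forestDegree n :=
  Finsupp.sum_add_index' (by simp) (by intros; ring)

@[simp]
theorem forestDegree_zero : forestDegree (0 : Tree A →₀ ℕ) = 0 := by
  simp [forestDegree]

@[simp]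
theorem forestDegree_single (τ : Tree A) : forestDegree (Finsupp.single τ 1) = τ.degree := by
  simp [forestDegree]

theorem forestDegree_eq_zero_iff (m : Tree A →₀ ℕ) : forestDegree m = 0 ↔ m = 0 := by
  constructor
  · intro h
    ext τ
    by_contra hτ
    have hmem : τ ∈ m.support := Finsupp.mem_support_iff.2 hτ
    have h0 := (Finset.sum_eq_zero_iff.1 h) τ hmem
    rcases Nat.mul_eq_zero.1 h0 with h0 | h0
    · exact hτ h0
    · exact τ.degree_pos.ne' h0
  · rintro rfl
    simp

theorem forestDegree_pos {m : Tree A →₀ ℕ} (hm : m ≠ 0) : 0 < forestDegree m :=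
  Nat.pos_of_ne_zero fun h => hm ((forestDegree_eq_zero_iff m).1 h)

/-- A property of forests holds if it is stable under multiplication and holds for the empty
forest and for trees. -/
theorem forest_induction_tree {P : (Tree A →₀ ℕ) → Prop} (zero : P 0)
    (tree : ∀ τ, P (Finsupp.single τ 1)) (add : ∀ m n, P m → P n → P (m + n))
    (m : Tree A →₀ ℕ) : P m := by
  induction m using Finsupp.induction_linear with
  | zero => exact zero
  | add m n hm hn => exact add m n hm hn
  | single τ k =>
    induction k with
    | zero => simpa using zero
    | succ k ih =>
      rw [Finsupp.single_add]
      exact add _ _ ih (tree τ)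

theorem sum_degree_toMultiset (m : Tree A →₀ ℕ) :
    ((Finsupp.toMultiset m).map Tree.degree).sum = forestDegree m := by
  induction m using forest_induction_tree with
  | zero => simp
  | tree τ => simp
  | add m n hm hn => simp [forestDegree_add, hm, hn]

theorem degree_graft_toMultiset (a : A) (m : Tree A →₀ ℕ) :
    (Tree.graft a (Finsupp.toMultiset m)).degree = forestDegree m + 1 := by
  rw [Tree.degree_graft, sum_degree_toMultiset, add_comm]

theorem graftLin_forest (a : A) (m : Tree A →₀ ℕ) :
    graftLin a (forest m) = MvPolynomial.X (Tree.graft a (Finsupp.toMultiset m)) := by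
  have h := (MvPolynomial.basisMonomials (Tree A) ℝ).constr_basis ℝ
    (fun m => (MvPolynomial.X (Tree.graft a (Finsupp.toMultiset m)) : CK A)) m
  rw [MvPolynomial.coe_basisMonomials] at h
  exact h

/-- Induction over forests: every forest arises from the empty one by grafting onto a new root and
by multiplication. -/
theorem forest_induction {P : (Tree A →₀ ℕ) → Prop} (zero : P 0)
    (graft : ∀ a m, P m → P (Finsupp.single (Tree.graft a (Finsupp.toMultiset m)) 1))
    (add : ∀ m n, P m → P n → P (m + n)) (m : Tree A →₀ ℕ) : P m := by
  have key : ∀ n : ℕ, ∀ m : Tree A →₀ ℕ, forestDegree m ≤ n → P m := by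
    intro n
    induction n with
    | zero =>
      intro m hm
      rw [(forestDegree_eq_zero_iff m).1 (by omega)]
      exact zero
    | succ n ih =>
      intro m
      induction m using forest_induction_tree with
      | zero => exact fun _ => zero
      | tree τ =>
        intro hτ
        obtain ⟨a, F, rfl⟩ := τ.exists_eq_graft
        obtain ⟨m, rfl⟩ : ∃ m : Tree A →₀ ℕ, Finsupp.toMultiset m = F := by
          classical exact ⟨_, Multiset.toFinsupp_toMultiset F⟩
        rw [forestDegree_single, degree_graft_toMultiset] at hτ
        exact graft a m (ih m (by omega))
      | add m k hm hk =>
        intro h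
        rw [forestDegree_add] at h
        exact add m k (hm (by omega)) (hk (by omega))
  exact key _ m le_rfl

/-- Two linear maps on the Connes–Kreimer algebra agree if they agree on forests. -/
theorem CK.linearMap_ext {M : Type*} [AddCommMonoid M] [Module ℝ M] {f g : CK A →ₗ[ℝ] M}
    (h : ∀ m, f (forest m) = g (forest m)) : f = g := by
  refine (MvPolynomial.basisMonomials (Tree A) ℝ).ext fun m => ?_
  rw [MvPolynomial.coe_basisMonomials]
  exact h m

theorem coproduct_X (τ : Tree A) : coproduct (MvPolynomial.X τ) = coproductTree τ :=
  MvPolynomial.aeval_X _ _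

theorem coproduct_forest_eq_prod (m : Tree A →₀ ℕ) :
    coproduct (forest m) = ((Finsupp.toMultiset m).map coproductTree).prod := by
  induction m using forest_induction_tree with
  | zero => simp [forest_zero]
  | tree τ => simp [forest_single, coproduct_X]
  | add m n hm hn => simp [forest_add, hm, hn]

theorem coproduct_graftLin_forest (a : A) (m : Tree A →₀ ℕ) :
    coproduct (graftLin a (forest m)) = graftLin a (forest m) ⊗ₜ 1
      + TensorProduct.map LinearMap.id (graftLin a) (coproduct (forest m)) := by
  obtain ⟨l, hl⟩ := Tree.exists_map_mk (Finsupp.toMultiset m)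
  rw [coproduct_forest_eq_prod, graftLin_forest, coproduct_X, hl, Tree.graft_mk]
  refine (coproductPlanar_node a l).trans ?_
  rw [Multiset.map_coe, Multiset.prod_coe, List.map_map]
  rfl

theorem coproduct_graftLin (a : A) (h : CK A) :
    coproduct (graftLin a h) = graftLin a h ⊗ₜ 1
      + TensorProduct.map LinearMap.id (graftLin a) (coproduct h) := by
  have := CK.linearMap_ext (f := coproduct.toLinearMap ∘ₗ graftLin a)
    (g := (TensorProduct.mk ℝ (CK A) (CK A)).flip 1 ∘ₗ graftLin a
      + TensorProduct.map LinearMap.id (graftLin a) ∘ₗ coproduct.toLinearMap)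
    (fun m => coproduct_graftLin_forest a m)
  exact LinearMap.congr_fun this h

/-! ### Coassociativity -/

theorem coproduct_coassoc_forest (m : Tree A →₀ ℕ) :
    Algebra.TensorProduct.assoc ℝ ℝ ℝ (CK A) (CK A) (CK A)
      (Algebra.TensorProduct.map coproduct (AlgHom.id ℝ (CK A)) (coproduct (forest m))) =
    Algebra.TensorProduct.map (AlgHom.id ℝ (CK A)) coproduct (coproduct (forest m)) := by
  induction m using forest_induction with
  | zero => simp [forest_zero]
  | add m n hm hn => simp only [forest_add, map_mul, hm, hn]
  | graft a m ih =>
    -- Both sides equal `τ ⊗ 1 ⊗ 1`, plus the terms in which the root is cut off from the last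
    -- factor, plus the terms in which it stays there; the latter agree by induction.
    have e₁ : ∀ y : CK A ⊗[ℝ] CK A,
        Algebra.TensorProduct.assoc ℝ ℝ ℝ (CK A) (CK A) (CK A)
          (Algebra.TensorProduct.map coproduct (AlgHom.id ℝ (CK A))
            (TensorProduct.map LinearMap.id (graftLin a) y)) =
        TensorProduct.map LinearMap.id (TensorProduct.map LinearMap.id (graftLin a))
          (Algebra.TensorProduct.assoc ℝ ℝ ℝ (CK A) (CK A) (CK A)
            (Algebra.TensorProduct.map coproduct (AlgHom.id ℝ (CK A)) y)) := by
      intro y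
      induction y using TensorProduct.induction_on with
      | zero => simp
      | add y z hy hz => simp only [map_add, hy, hz]
      | tmul u v =>
        simp only [TensorProduct.map_tmul, Algebra.TensorProduct.map_tmul, LinearMap.id_apply,
          AlgHom.id_apply]
        induction coproduct u using TensorProduct.induction_on with
        | zero => simp
        | add y z hy hz => simp only [TensorProduct.add_tmul, map_add, hy, hz]
        | tmul u w => simp
    have e₂ : ∀ y : CK A ⊗[ℝ] CK A,
        Algebra.TensorProduct.map (AlgHom.id ℝ (CK A)) coproduct
            (TensorProduct.map LinearMap.id (graftLin a) y) =
          Algebra.TensorProduct.assoc ℝ ℝ ℝ (CK A) (CK A) (CK A)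
            (TensorProduct.map LinearMap.id (graftLin a) y ⊗ₜ 1) +
          TensorProduct.map LinearMap.id (TensorProduct.map LinearMap.id (graftLin a))
            (Algebra.TensorProduct.map (AlgHom.id ℝ (CK A)) coproduct y) := by
      intro y
      induction y using TensorProduct.induction_on with
      | zero => simp
      | add y z hy hz =>
        simp only [map_add, hy, hz, TensorProduct.add_tmul]
        abel
      | tmul u v => simp [coproduct_graftLin, TensorProduct.tmul_add]
    rw [forest_single, ← graftLin_forest, coproduct_graftLin]
    simp only [map_add, e₁, e₂, ih]
    simp [coproduct_graftLin, TensorProduct.add_tmul, Algebra.TensorProduct.one_def, add_assoc]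

theorem coproduct_coassoc (h : CK A) :
    Algebra.TensorProduct.assoc ℝ ℝ ℝ (CK A) (CK A) (CK A)
      (Algebra.TensorProduct.map coproduct (AlgHom.id ℝ (CK A)) (coproduct h)) =
    Algebra.TensorProduct.map (AlgHom.id ℝ (CK A)) coproduct (coproduct h) := by
  have := CK.linearMap_ext
    (f := (((Algebra.TensorProduct.assoc ℝ ℝ ℝ (CK A) (CK A) (CK A)).toAlgHom.comp
      (Algebra.TensorProduct.map coproduct (AlgHom.id ℝ (CK A)))).comp coproduct).toLinearMap)
    (g := ((Algebra.TensorProduct.map (AlgHom.id ℝ (CK A)) coproduct).comp coproduct).toLinearMap)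
    coproduct_coassoc_forest
  exact LinearMap.congr_fun this h

/-! ### Convolution and characters -/

/-- The functional `f ⊗ g` on the tensor square of the Connes–Kreimer algebra. -/
def tensorPair (f g : CK A →ₗ[ℝ] ℝ) : CK A ⊗[ℝ] CK A →ₗ[ℝ] ℝ :=
  LinearMap.mul' ℝ ℝ ∘ₗ TensorProduct.map f g

@[simp]
theorem tensorPair_tmul (f g : CK A →ₗ[ℝ] ℝ) (u v : CK A) :
    tensorPair f g (u ⊗ₜ v) = f u * g v := rfl

theorem convolution_apply (f g : CK A →ₗ[ℝ] ℝ) (h : CK A) :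
    convolution f g h = tensorPair f g (coproduct h) := rfl

theorem convolution_assoc (f g k : CK A →ₗ[ℝ] ℝ) :
    convolution (convolution f g) k = convolution f (convolution g k) := by
  refine LinearMap.ext fun h => ?_
  have e₁ : ∀ y : CK A ⊗[ℝ] CK A, tensorPair (convolution f g) k y =
      LinearMap.mul' ℝ ℝ (TensorProduct.map f (tensorPair g k)
        (Algebra.TensorProduct.assoc ℝ ℝ ℝ (CK A) (CK A) (CK A)
          (Algebra.TensorProduct.map coproduct (AlgHom.id ℝ (CK A)) y))) := by
    intro y
    induction y using TensorProduct.induction_on with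
    | zero => simp
    | add y z hy hz => simp only [map_add, hy, hz]
    | tmul u v =>
      rw [tensorPair_tmul, convolution_apply, Algebra.TensorProduct.map_tmul]
      induction coproduct u using TensorProduct.induction_on with
      | zero => simp
      | add y z hy hz => simp only [map_add, add_mul, TensorProduct.add_tmul, hy, hz]
      | tmul u w => simp [mul_assoc]
  have e₂ : ∀ y : CK A ⊗[ℝ] CK A, tensorPair f (convolution g k) y =
      LinearMap.mul' ℝ ℝ (TensorProduct.map f (tensorPair g k)
          (Algebra.TensorProduct.map (AlgHom.id ℝ (CK A)) coproduct y)) := by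
    intro y
    induction y using TensorProduct.induction_on with
    | zero => simp
    | add y z hy hz => simp only [map_add, hy, hz]
    | tmul u v => simp [convolution_apply]
  rw [convolution_apply, convolution_apply, e₁, e₂, coproduct_coassoc]

theorem convolution_graftLin (f g : CK A →ₗ[ℝ] ℝ) (a : A) (h : CK A) :
    convolution f g (graftLin a h) =
      f (graftLin a h) * g 1 + convolution f (g ∘ₗ graftLin a) h := by
  rw [convolution_apply, coproduct_graftLin, map_add, tensorPair_tmul, convolution_apply]
  congr 1
  induction coproduct h using TensorProduct.induction_on with
  | zero => simp
  | add y z hy hz => simp only [map_add, hy, hz]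
  | tmul u v => rfl

/-- The character of the Connes–Kreimer algebra with prescribed values on trees. -/
def character (φ : Tree A → ℝ) : CK A →ₐ[ℝ] ℝ := MvPolynomial.aeval φ

@[simp]
theorem character_X (φ : Tree A → ℝ) (τ : Tree A) : character φ (MvPolynomial.X τ) = φ τ :=
  MvPolynomial.aeval_X _ _

theorem convolution_one (f g : CK A →ₗ[ℝ] ℝ) : convolution f g 1 = f 1 * g 1 := by
  rw [convolution_apply, map_one, Algebra.TensorProduct.one_def, tensorPair_tmul]

theorem convolution_mul (f g : CK A →ₐ[ℝ] ℝ) (u v : CK A) :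
    convolution f.toLinearMap g.toLinearMap (u * v) =
      convolution f.toLinearMap g.toLinearMap u * convolution f.toLinearMap g.toLinearMap v := by
  have h : ∀ y, tensorPair f.toLinearMap g.toLinearMap y =
      (Algebra.TensorProduct.lmul' ℝ (S := ℝ)).comp (Algebra.TensorProduct.map f g) y := by
    intro y
    induction y using TensorProduct.induction_on with
    | zero => simp
    | add y z hy hz => simp only [map_add, hy, hz]
    | tmul u v => simp
  simp only [convolution_apply, h, map_mul]

/-- Two linear functionals which are multiplicative in low degrees agree on the forests of low
degree if they do so on trees. -/
theorem eq_on_forest_of_eq_on_tree {f g : CK A →ₗ[ℝ] ℝ} {N : ℕ∞} (hf1 : f 1 = 1) (hg1 : g 1 = 1)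
    (hf : ∀ m n : Tree A →₀ ℕ, ((forestDegree m + forestDegree n : ℕ) : ℕ∞) ≤ N →
      f (forest m * forest n) = f (forest m) * f (forest n))
    (hg : ∀ m n : Tree A →₀ ℕ, ((forestDegree m + forestDegree n : ℕ) : ℕ∞) ≤ N →
      g (forest m * forest n) = g (forest m) * g (forest n))
    (h : ∀ τ : Tree A, (τ.degree : ℕ∞) ≤ N → f (MvPolynomial.X τ) = g (MvPolynomial.X τ))
    (m : Tree A →₀ ℕ) : (forestDegree m : ℕ∞) ≤ N → f (forest m) = g (forest m) := by
  induction m using forest_induction_tree with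
  | zero => exact fun _ => by rw [forest_zero, hf1, hg1]
  | tree τ =>
    intro hτ
    rw [forestDegree_single] at hτ
    exact h τ hτ
  | add m n hm hn =>
    intro hmn
    rw [forestDegree_add] at hmn
    rw [forest_add, hf m n hmn, hg m n hmn,
      hm (le_trans (by exact_mod_cast Nat.le_add_right _ _) hmn),
      hn (le_trans (by exact_mod_cast Nat.le_add_left _ _) hmn)]

/-! ### The reduced coproduct -/

/-- The span of the tensors `a ⊗ b` of nonempty forests of total degree `n`. -/
def reducedSpan (A : Type*) (n : ℕ) : Submodule ℝ (CK A ⊗[ℝ] CK A) :=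
  Submodule.span ℝ {y | ∃ a b : Tree A →₀ ℕ, a ≠ 0 ∧ b ≠ 0 ∧
    forestDegree a + forestDegree b = n ∧ y = forest a ⊗ₜ forest b}

theorem tmul_mem_reducedSpan {a b : Tree A →₀ ℕ} (ha : a ≠ 0) (hb : b ≠ 0) {n : ℕ}
    (h : forestDegree a + forestDegree b = n) : forest a ⊗ₜ forest b ∈ reducedSpan A n :=
  Submodule.subset_span ⟨a, b, ha, hb, h, rfl⟩

theorem tmul_mul_mem_reducedSpan (a b : Tree A →₀ ℕ) {k n : ℕ}
    (h : forestDegree a + forestDegree b + k = n) {y : CK A ⊗[ℝ] CK A}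
    (hy : y ∈ reducedSpan A k) : forest a ⊗ₜ forest b * y ∈ reducedSpan A n := by
  induction hy using Submodule.span_induction with
  | zero => simp
  | add y z _ _ hy hz => rw [mul_add]; exact add_mem hy hz
  | smul c y _ hy => rw [mul_smul_comm]; exact Submodule.smul_mem _ _ hy
  | mem y hy =>
    obtain ⟨c, d, hc, hd, rfl, rfl⟩ := hy
    rw [Algebra.TensorProduct.tmul_mul_tmul, ← forest_add, ← forest_add]
    refine tmul_mem_reducedSpan (by simp [hc]) (by simp [hd]) ?_
    rw [forestDegree_add, forestDegree_add, ← h]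
    ring

theorem mul_mem_reducedSpan {k l n : ℕ} (h : k + l = n) {y z : CK A ⊗[ℝ] CK A}
    (hy : y ∈ reducedSpan A k) (hz : z ∈ reducedSpan A l) : y * z ∈ reducedSpan A n := by
  induction hy using Submodule.span_induction with
  | zero => simp
  | add y y' _ _ hy hy' => rw [add_mul]; exact add_mem hy hy'
  | smul c y _ hy => rw [smul_mul_assoc]; exact Submodule.smul_mem _ _ hy
  | mem y hy =>
    obtain ⟨c, d, hc, hd, rfl, rfl⟩ := hy
    exact tmul_mul_mem_reducedSpan _ _ h hz

/-- The reduced coproduct `Δ m - m ⊗ 1 - 1 ⊗ m` of a forest `m`. -/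
def reducedCoproduct (m : Tree A →₀ ℕ) : CK A ⊗[ℝ] CK A :=
  coproduct (forest m) - forest m ⊗ₜ 1 - 1 ⊗ₜ forest m

theorem coproduct_forest (m : Tree A →₀ ℕ) :
    coproduct (forest m) = reducedCoproduct m + forest m ⊗ₜ 1 + 1 ⊗ₜ forest m := by
  rw [reducedCoproduct]
  abel

/-- Grafting the right factor of a tensor of nonempty forests onto a new root raises the degree
by one. -/
theorem map_graftLin_mem_reducedSpan (a : A) {n : ℕ} {y : CK A ⊗[ℝ] CK A}
    (hy : y ∈ reducedSpan A n) :
    TensorProduct.map LinearMap.id (graftLin a) y ∈ reducedSpan A (n + 1) := by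
  induction hy using Submodule.span_induction with
  | zero => simp
  | add y z _ _ hy hz => rw [map_add]; exact add_mem hy hz
  | smul c y _ hy => rw [map_smul]; exact Submodule.smul_mem _ _ hy
  | mem y hy =>
    obtain ⟨c, d, hc, hd, rfl, rfl⟩ := hy
    rw [TensorProduct.map_tmul, graftLin_forest, ← forest_single]
    refine tmul_mem_reducedSpan hc (by simp) ?_
    rw [forestDegree_single, degree_graft_toMultiset]
    ring

/-- The reduced coproduct of a nonempty forest only involves nonempty forests. -/
theorem reducedCoproduct_mem (m : Tree A →₀ ℕ) (hm : m ≠ 0) :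
    reducedCoproduct m ∈ reducedSpan A (forestDegree m) := by
  induction m using forest_induction with
  | zero => exact absurd rfl hm
  | graft a m ih =>
    rw [reducedCoproduct, forest_single, ← graftLin_forest, coproduct_graftLin,
      forestDegree_single, degree_graft_toMultiset, add_sub_cancel_left]
    rcases eq_or_ne m 0 with rfl | hm
    · simp [forest_zero, Algebra.TensorProduct.one_def]
    · rw [coproduct_forest, map_add, map_add, TensorProduct.map_tmul, TensorProduct.map_tmul,
        LinearMap.id_apply, LinearMap.id_apply, add_sub_cancel_right]
      refine add_mem (map_graftLin_mem_reducedSpan a (ih hm)) ?_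
      rw [← forest_zero, graftLin_forest, ← forest_single]
      exact tmul_mem_reducedSpan hm (by simp)
        (by rw [forestDegree_single, degree_graft_toMultiset, forestDegree_zero])
  | add m n ihm ihn =>
    rcases eq_or_ne m 0 with rfl | hm'
    · rw [zero_add] at hm ⊢; exact ihn hm
    rcases eq_or_ne n 0 with rfl | hn'
    · rw [add_zero] at hm ⊢; exact ihm hm
    replace ihm := ihm hm'
    replace ihn := ihn hn'
    have e : reducedCoproduct (m + n) =
        forest m ⊗ₜ forest n + forest n ⊗ₜ forest m
          + (forest m ⊗ₜ forest 0 * reducedCoproduct n + forest 0 ⊗ₜ forest m * reducedCoproduct n)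
          + (forest n ⊗ₜ forest 0 * reducedCoproduct m + forest 0 ⊗ₜ forest n * reducedCoproduct m)
          + reducedCoproduct m * reducedCoproduct n := by
      rw [reducedCoproduct, forest_add, map_mul, coproduct_forest m, coproduct_forest n]
      have h1 : (forest m * forest n) ⊗ₜ[ℝ] (1 : CK A) = forest m ⊗ₜ 1 * forest n ⊗ₜ 1 := by simp
      have h2 : (1 : CK A) ⊗ₜ[ℝ] (forest m * forest n) = 1 ⊗ₜ forest m * 1 ⊗ₜ forest n := by simp
      have h3 : forest m ⊗ₜ[ℝ] forest n = forest m ⊗ₜ 1 * 1 ⊗ₜ forest n := by simp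
      have h4 : forest n ⊗ₜ[ℝ] forest m = forest n ⊗ₜ 1 * 1 ⊗ₜ forest m := by simp
      rw [h1, h2, h3, h4, forest_zero]
      ring
    have hd := forestDegree_add m n
    rw [e]
    refine add_mem (add_mem (add_mem (add_mem ?_ ?_) (add_mem ?_ ?_)) (add_mem ?_ ?_)) ?_
    · exact tmul_mem_reducedSpan hm' hn' hd.symm
    · exact tmul_mem_reducedSpan hn' hm' (by omega)
    · exact tmul_mul_mem_reducedSpan _ _ (by simp; omega) ihn
    · exact tmul_mul_mem_reducedSpan _ _ (by simp; omega) ihn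
    · exact tmul_mul_mem_reducedSpan _ _ (by simp; omega) ihm
    · exact tmul_mul_mem_reducedSpan _ _ (by simp; omega) ihm
    · exact mul_mem_reducedSpan hd.symm ihm ihn

theorem convolution_forest (f g : CK A →ₗ[ℝ] ℝ) (hf : f 1 = 1) (hg : g 1 = 1)
    (m : Tree A →₀ ℕ) : convolution f g (forest m) =
      f (forest m) + g (forest m) + tensorPair f g (reducedCoproduct m) := by
  rw [convolution_apply, reducedCoproduct, map_sub, map_sub, tensorPair_tmul, tensorPair_tmul,
    hf, hg]
  ring

/-- On tensors of nonempty forests of total degree `n`, the functional `f ⊗ g` only depends on the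
values of `f` and `g` on forests of degree less than `n`. -/
theorem tensorPair_congr {f f' g g' : CK A →ₗ[ℝ] ℝ} {n : ℕ}
    (hf : ∀ m, forestDegree m < n → f (forest m) = f' (forest m))
    (hg : ∀ m, forestDegree m < n → g (forest m) = g' (forest m))
    {y : CK A ⊗[ℝ] CK A} (hy : y ∈ reducedSpan A n) : tensorPair f g y = tensorPair f' g' y := by
  induction hy using Submodule.span_induction with
  | zero => simp
  | add y z _ _ hy hz => rw [map_add, map_add, hy, hz]
  | smul c y _ hy => rw [map_smul, map_smul, hy]
  | mem y hy =>
    obtain ⟨c, d, hc, hd, rfl, rfl⟩ := hy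
    have := forestDegree_pos hc
    have := forestDegree_pos hd
    rw [tensorPair_tmul, tensorPair_tmul, hf c (by omega), hg d (by omega)]

end Algebra

/-! ### The sewing lemma -/

namespace Sewing

/-- The sum of the germ `Ξ` along the dyadic points of mesh `2⁻ⁿ` of `[0, t]` and the end point
`t`. -/
def dyadicSum (Ξ : ℝ → ℝ → ℝ) (n : ℕ) (t : ℝ) : ℝ :=
  ∑ k ∈ Finset.range ⌊t * 2 ^ n⌋₊, Ξ (k / 2 ^ n) ((k + 1) / 2 ^ n) +
    Ξ (⌊t * 2 ^ n⌋₊ / 2 ^ n) t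

/-- The change of `dyadicSum` under the passage from mesh `2⁻ⁿ` to mesh `2⁻ⁿ⁻¹`, in terms of the
defect of additivity `R` of the germ. -/
def dyadicStep (R : ℝ → ℝ → ℝ → ℝ) (n : ℕ) (t : ℝ) : ℝ :=
  ∑ k ∈ Finset.range ⌊t * 2 ^ n⌋₊, R (k / 2 ^ n) ((2 * k + 1) / 2 ^ (n + 1)) ((k + 1) / 2 ^ n) +
    R (⌊t * 2 ^ n⌋₊ / 2 ^ n) (⌊t * 2 ^ (n + 1)⌋₊ / 2 ^ (n + 1)) t

variable {R : ℝ → ℝ → ℝ → ℝ}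

theorem degenerate_left (hR : ∀ r s u t, R r s u + R r u t = R s u t + R r s t)
    (h0 : ∀ r, R r r r = 0) (r t : ℝ) : R r r t = 0 := by
  have := hR r r r t
  have := h0 r
  linarith

theorem degenerate_right (hR : ∀ r s u t, R r s u + R r u t = R s u t + R r s t)
    (h0 : ∀ r, R r r r = 0) (r t : ℝ) : R r t t = 0 := by
  have := hR r t t t
  have := h0 t
  linarith

theorem sum_range_two_mul (g : ℕ → ℝ) (K : ℕ) :
    ∑ k ∈ Finset.range (2 * K), g k = ∑ k ∈ Finset.range K, (g (2 * k) + g (2 * k + 1)) := by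
  induction K with
  | zero => simp
  | succ K ih =>
    rw [Nat.mul_succ, Finset.sum_range_succ, Finset.sum_range_succ, ih, Finset.sum_range_succ]
    ring

theorem floor_two_mul (x : ℝ) (hx : 0 ≤ x) :
    ⌊x * 2⌋₊ = 2 * ⌊x⌋₊ ∨ ⌊x * 2⌋₊ = 2 * ⌊x⌋₊ + 1 := by
  have h1 := Nat.floor_le hx
  have h2 := Nat.lt_floor_add_one x
  have h3 : 2 * ⌊x⌋₊ ≤ ⌊x * 2⌋₊ := Nat.le_floor (by push_cast; linarith)
  have h4 : ⌊x * 2⌋₊ < 2 * ⌊x⌋₊ + 2 := (Nat.floor_lt (by linarith)).2 (by push_cast; linarith)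
  omega

theorem dyadicSum_succ (hR : ∀ r s u t, R r s u + R r u t = R s u t + R r s t)
    (h0 : ∀ r, R r r r = 0) (n : ℕ) {t : ℝ} (ht : 0 ≤ t) :
    dyadicSum (R 0) (n + 1) t = dyadicSum (R 0) n t + dyadicStep R n t := by
  have e : t * 2 ^ (n + 1) = t * 2 ^ n * 2 := by ring
  have hsum : ∑ k ∈ Finset.range (2 * ⌊t * 2 ^ n⌋₊),
        R 0 (k / 2 ^ (n + 1)) ((k + 1) / 2 ^ (n + 1)) =
      ∑ k ∈ Finset.range ⌊t * 2 ^ n⌋₊, R 0 (k / 2 ^ n) ((k + 1) / 2 ^ n) +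
      ∑ k ∈ Finset.range ⌊t * 2 ^ n⌋₊,
        R (k / 2 ^ n) ((2 * k + 1) / 2 ^ (n + 1)) ((k + 1) / 2 ^ n) := by
    rw [sum_range_two_mul, ← Finset.sum_add_distrib]
    refine Finset.sum_congr rfl fun k _ => ?_
    have e1 : ((2 * k : ℕ) : ℝ) / 2 ^ (n + 1) = k / 2 ^ n := by
      push_cast; field_simp; ring
    have e2 : (((2 * k + 1 : ℕ) : ℝ) + 1) / 2 ^ (n + 1) = (k + 1) / 2 ^ n := by
      push_cast; field_simp; ring
    have e3 : ((2 * k + 1 : ℕ) : ℝ) / 2 ^ (n + 1) = (2 * k + 1) / 2 ^ (n + 1) := by push_cast; rfl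
    have e4 : (((2 * k : ℕ) : ℝ) + 1) / 2 ^ (n + 1) = (2 * k + 1) / 2 ^ (n + 1) := by
      push_cast; rfl
    rw [e1, e2, e3, e4, hR]
    ring
  have e1 : ((2 * ⌊t * 2 ^ n⌋₊ : ℕ) : ℝ) / 2 ^ (n + 1) = ⌊t * 2 ^ n⌋₊ / 2 ^ n := by
    push_cast; field_simp; ring
  unfold dyadicSum dyadicStep
  rcases floor_two_mul (t * 2 ^ n) (by positivity) with h | h
  · rw [e, h, hsum, e1, degenerate_left hR h0]
    ring
  · rw [e, h, Finset.sum_range_succ, hsum]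
    have e2 : (((2 * ⌊t * 2 ^ n⌋₊ : ℕ) : ℝ) + 1) / 2 ^ (n + 1) =
        ((2 * ⌊t * 2 ^ n⌋₊ + 1 : ℕ) : ℝ) / 2 ^ (n + 1) := by push_cast; rfl
    rw [e1, e2]
    linarith [hR 0 (⌊t * 2 ^ n⌋₊ / 2 ^ n) (((2 * ⌊t * 2 ^ n⌋₊ + 1 : ℕ) : ℝ) / 2 ^ (n + 1)) t]

theorem floor_div_le {t : ℝ} (ht : 0 ≤ t) (n : ℕ) : (⌊t * 2 ^ n⌋₊ : ℝ) / 2 ^ n ≤ t := by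
  rw [div_le_iff₀ (by positivity)]
  exact Nat.floor_le (by positivity)

theorem lt_floor_div_add (t : ℝ) (n : ℕ) : t < (⌊t * 2 ^ n⌋₊ : ℝ) / 2 ^ n + (2 ^ n)⁻¹ := by
  have h := Nat.lt_floor_add_one (t * 2 ^ n)
  have h2 : (0 : ℝ) < 2 ^ n := by positivity
  rw [← one_div, ← add_div, lt_div_iff₀ h2]
  exact h

theorem floor_mul_le_add {s t : ℝ} (hs : 0 ≤ s) (n : ℕ) (hst : t ≤ s + (2 ^ n)⁻¹) :
    ⌊t * 2 ^ n⌋₊ ≤ ⌊s * 2 ^ n⌋₊ + 1 := by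
  have h : t * 2 ^ n ≤ s * 2 ^ n + 1 := by
    calc t * 2 ^ n ≤ (s + (2 ^ n)⁻¹) * 2 ^ n := by gcongr
      _ = s * 2 ^ n + 1 := by field_simp
  calc ⌊t * 2 ^ n⌋₊ ≤ ⌊s * 2 ^ n + 1⌋₊ := Nat.floor_mono h
    _ = _ := Nat.floor_add_one (by positivity)

/-- On intervals shorter than the mesh, the dyadic sum is close to the germ. -/
theorem abs_dyadicSum_sub_le (hR : ∀ r s u t, R r s u + R r u t = R s u t + R r s t)
    {D : ℝ} (n : ℕ)
    (hD : ∀ s u t : ℝ, s ≤ u → u ≤ s + (2 ^ n)⁻¹ → u ≤ t → t ≤ u + (2 ^ n)⁻¹ → |R s u t| ≤ D)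
    {s t : ℝ} (hs : 0 ≤ s) (hst : s ≤ t) (h : t ≤ s + (2 ^ n)⁻¹) :
    |dyadicSum (R 0) n t - dyadicSum (R 0) n s - R 0 s t| ≤ 2 * D := by
  have ht : 0 ≤ t := hs.trans hst
  have h0 : (0 : ℝ) < (2 ^ n)⁻¹ := by positivity
  have hD0 : 0 ≤ D := (abs_nonneg _).trans (hD 0 0 0 le_rfl (by simp) le_rfl (by simp))
  have h1 : ⌊s * 2 ^ n⌋₊ ≤ ⌊t * 2 ^ n⌋₊ := Nat.floor_mono (by gcongr)
  have h2 := floor_mul_le_add hs n h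
  have hs1 := floor_div_le hs n
  have hs2 := lt_floor_div_add s n
  have ht1 := floor_div_le ht n
  have ht2 := lt_floor_div_add t n
  unfold dyadicSum
  rcases (show ⌊t * 2 ^ n⌋₊ = ⌊s * 2 ^ n⌋₊ ∨ ⌊t * 2 ^ n⌋₊ = ⌊s * 2 ^ n⌋₊ + 1 by omega) with hk | hk
  · rw [hk] at ht2 ⊢
    set a : ℝ := ⌊s * 2 ^ n⌋₊ / 2 ^ n
    have := hR 0 a s t
    have hb := hD a s t hs1 hs2.le hst h
    rw [abs_le] at hb ⊢
    constructor <;> linarith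
  · rw [hk] at ht1 ht2 ⊢
    have eb : ((⌊s * 2 ^ n⌋₊ + 1 : ℕ) : ℝ) / 2 ^ n = ((⌊s * 2 ^ n⌋₊ : ℝ) + 1) / 2 ^ n := by
      push_cast; rfl
    have eb' : ((⌊s * 2 ^ n⌋₊ : ℝ) + 1) / 2 ^ n = (⌊s * 2 ^ n⌋₊ : ℝ) / 2 ^ n + (2 ^ n)⁻¹ := by
      rw [add_div, one_div]
    rw [Finset.sum_range_succ, eb]
    rw [eb] at ht1 ht2
    set b : ℝ := ((⌊s * 2 ^ n⌋₊ : ℝ) + 1) / 2 ^ n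
    set a : ℝ := ⌊s * 2 ^ n⌋₊ / 2 ^ n
    have q1 := hR 0 a s b
    have q2 := hR 0 s b t
    have b1 := hD a s b hs1 hs2.le (by linarith) (by linarith)
    have b2 := hD s b t (by linarith) (by linarith) (by linarith) (by linarith)
    rw [abs_le] at b1 b2 ⊢
    constructor <;> linarith

theorem abs_dyadicStep_sub_le {D : ℝ} (n : ℕ)
    (hD : ∀ s u t : ℝ, s ≤ u → u ≤ s + (2 ^ n)⁻¹ → u ≤ t → t ≤ u + (2 ^ n)⁻¹ → |R s u t| ≤ D)
    {s t : ℝ} (hs : 0 ≤ s) (hst : s ≤ t) :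
    |dyadicStep R n t - dyadicStep R n s| ≤ ((t - s) * 2 ^ n + 3) * D := by
  have ht : 0 ≤ t := hs.trans hst
  have h0 : (0 : ℝ) < (2 ^ n)⁻¹ := by positivity
  have hD0 : 0 ≤ D := (abs_nonneg _).trans (hD 0 0 0 le_rfl (by simp) le_rfl (by simp))
  have h1 : ⌊s * 2 ^ n⌋₊ ≤ ⌊t * 2 ^ n⌋₊ := Nat.floor_mono (by gcongr)
  have hcard : ((⌊t * 2 ^ n⌋₊ - ⌊s * 2 ^ n⌋₊ : ℕ) : ℝ) ≤ (t - s) * 2 ^ n + 1 := by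
    rw [Nat.cast_sub h1]
    have := Nat.floor_le (show 0 ≤ t * 2 ^ n by positivity)
    have := Nat.lt_floor_add_one (s * 2 ^ n)
    linarith
  have hmid : ∀ k : ℕ, |R (k / 2 ^ n) ((2 * k + 1) / 2 ^ (n + 1)) ((k + 1) / 2 ^ n)| ≤ D := by
    intro k
    have e1 : (2 * (k : ℝ) + 1) / 2 ^ (n + 1) = k / 2 ^ n + (2 ^ n)⁻¹ / 2 := by
      field_simp; ring
    have e2 : ((k : ℝ) + 1) / 2 ^ n = k / 2 ^ n + (2 ^ n)⁻¹ := by rw [add_div, one_div]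
    apply hD <;> rw [e1] <;> try rw [e2]
    all_goals linarith
  have hend : ∀ r : ℝ, 0 ≤ r →
      |R (⌊r * 2 ^ n⌋₊ / 2 ^ n) (⌊r * 2 ^ (n + 1)⌋₊ / 2 ^ (n + 1)) r| ≤ D := by
    intro r hr
    have e : r * 2 ^ (n + 1) = r * 2 ^ n * 2 := by ring
    have a1 := floor_div_le hr (n + 1)
    have a2 := lt_floor_div_add r (n + 1)
    have a3 := floor_div_le hr n
    have a4 := lt_floor_div_add r n
    have a5 : ((2 : ℝ) ^ (n + 1))⁻¹ = (2 ^ n)⁻¹ / 2 := by field_simp; ring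
    have a6 : (⌊r * 2 ^ n⌋₊ : ℝ) / 2 ^ n ≤ ⌊r * 2 ^ (n + 1)⌋₊ / 2 ^ (n + 1) := by
      rw [div_le_div_iff₀ (by positivity) (by positivity)]
      have : (2 * ⌊r * 2 ^ n⌋₊ : ℝ) ≤ ⌊r * 2 ^ (n + 1)⌋₊ := by
        rcases floor_two_mul (r * 2 ^ n) (by positivity) with h | h <;> rw [e, h] <;> push_cast <;>
          linarith
      calc (⌊r * 2 ^ n⌋₊ : ℝ) * 2 ^ (n + 1) = (2 * ⌊r * 2 ^ n⌋₊) * 2 ^ n := by ring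
        _ ≤ _ := by gcongr
    apply hD <;> linarith
  have hsplit : dyadicStep R n t - dyadicStep R n s =
      ∑ k ∈ Finset.Ico ⌊s * 2 ^ n⌋₊ ⌊t * 2 ^ n⌋₊,
        R (k / 2 ^ n) ((2 * k + 1) / 2 ^ (n + 1)) ((k + 1) / 2 ^ n)
      + R (⌊t * 2 ^ n⌋₊ / 2 ^ n) (⌊t * 2 ^ (n + 1)⌋₊ / 2 ^ (n + 1)) t
      - R (⌊s * 2 ^ n⌋₊ / 2 ^ n) (⌊s * 2 ^ (n + 1)⌋₊ / 2 ^ (n + 1)) s := by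
    rw [Finset.sum_Ico_eq_sub _ h1, dyadicStep, dyadicStep]
    ring
  have hsum : |∑ k ∈ Finset.Ico ⌊s * 2 ^ n⌋₊ ⌊t * 2 ^ n⌋₊,
      R (k / 2 ^ n) ((2 * k + 1) / 2 ^ (n + 1)) ((k + 1) / 2 ^ n)| ≤ ((t - s) * 2 ^ n + 1) * D := by
    refine (Finset.abs_sum_le_sum_abs _ _).trans ((Finset.sum_le_card_nsmul _ _ D
      fun k _ => hmid k).trans ?_)
    rw [Nat.card_Ico, nsmul_eq_mul]
    gcongr
  rw [hsplit]
  have b1 := hend t ht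
  have b2 := hend s hs
  rw [abs_le] at *
  constructor <;> linarith

theorem abs_le_mesh {β C : ℝ} (hβ : 0 ≤ β) (hC0 : 0 ≤ C)
    (hC : ∀ s u t, |R s u t| ≤ C * max |u - s| |t - u| ^ β) (n : ℕ) (s u t : ℝ)
    (h₁ : s ≤ u) (h₂ : u ≤ s + (2 ^ n)⁻¹) (h₃ : u ≤ t) (h₄ : t ≤ u + (2 ^ n)⁻¹) :
    |R s u t| ≤ C * ((2 ^ n)⁻¹ : ℝ) ^ β := by
  refine (hC s u t).trans ?_
  gcongr
  rw [abs_of_nonneg (by linarith), abs_of_nonneg (by linarith)]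
  exact max_le (by linarith) (by linarith)

/-- The contributions to the increments of the sewn function on an interval of length at most
`2⁻ⁿ` from meshes finer than `2⁻ⁿ` decay geometrically, because `β > 1`. -/
theorem abs_dyadicStep_add_sub_le {β C : ℝ} (hβ : 0 ≤ β) (hC0 : 0 ≤ C)
    (hC : ∀ s u t, |R s u t| ≤ C * max |u - s| |t - u| ^ β) {s t : ℝ} (hs : 0 ≤ s) (hst : s ≤ t)
    (n : ℕ) (h : t - s ≤ (2 ^ n)⁻¹) (i : ℕ) :
    |dyadicStep R (i + n) t - dyadicStep R (i + n) s| ≤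
      4 * C * ((2 ^ n)⁻¹ : ℝ) ^ β * ((2 : ℝ) ^ (1 - β)) ^ i := by
  refine (abs_dyadicStep_sub_le (i + n) (abs_le_mesh hβ hC0 hC (i + n)) hs hst).trans ?_
  have h1 : (t - s) * 2 ^ (i + n) ≤ 2 ^ i := by
    calc (t - s) * 2 ^ (i + n) ≤ (2 ^ n)⁻¹ * 2 ^ (i + n) := by gcongr
      _ = 2 ^ i := by rw [pow_add]; field_simp
  have h2 : (1 : ℝ) ≤ 2 ^ i := one_le_pow₀ (by norm_num)
  have h3 : (((2 : ℝ) ^ (i + n))⁻¹) ^ β = (((2 : ℝ) ^ n)⁻¹) ^ β * (((2 : ℝ) ^ i)⁻¹) ^ β := by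
    rw [← Real.mul_rpow (by positivity) (by positivity), pow_add, mul_inv, mul_comm]
  have h4 : ((2 : ℝ) ^ (1 - β)) ^ i = 2 ^ i * (((2 : ℝ) ^ i)⁻¹) ^ β := by
    rw [← Real.rpow_natCast, ← Real.rpow_natCast, ← Real.rpow_mul (by norm_num),
      ← Real.rpow_neg (by norm_num), ← Real.rpow_mul (by norm_num), ← Real.rpow_add (by norm_num)]
    congr 1
    ring
  calc ((t - s) * 2 ^ (i + n) + 3) * (C * (((2 : ℝ) ^ (i + n))⁻¹) ^ β)
      ≤ (4 * 2 ^ i) * (C * (((2 : ℝ) ^ (i + n))⁻¹) ^ β) := by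
        gcongr
        linarith
    _ = _ := by rw [h3, h4]; ring

/-- The sewing lemma on the unit interval: the germ `R 0` is close to an additive function. -/
theorem exists_of_unit {β C : ℝ} (hβ : 1 < β)
    (hR : ∀ r s u t, R r s u + R r u t = R s u t + R r s t)
    (hC : ∀ s u t, |R s u t| ≤ C * max |u - s| |t - u| ^ β) :
    ∃ j : ℝ → ℝ, ∃ K : ℝ, ∀ s t, 0 ≤ s → s ≤ t → t ≤ 1 →
      |j t - j s - R 0 s t| ≤ K * |t - s| ^ β := by
  have hβ0 : 0 ≤ β := by linarith
  have hC0 : 0 ≤ C := by simpa using (abs_nonneg _).trans (hC 0 0 1)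
  have h0 : ∀ r, R r r r = 0 := by
    intro r
    have := hC r r r
    rw [sub_self, abs_zero, max_self, Real.zero_rpow (by linarith), mul_zero] at this
    exact abs_nonpos_iff.1 this
  set q : ℝ := 2 ^ (1 - β) with hq
  have hq0 : 0 < q := by positivity
  have hq1 : q < 1 := Real.rpow_lt_one_of_one_lt_of_neg (by norm_num) (by linarith)
  have hstep0 : ∀ n, dyadicStep R n 0 = 0 := by
    intro n
    simp [dyadicStep, h0]
  have hsummable : ∀ t, 0 ≤ t → t ≤ 1 → Summable fun n => dyadicStep R n t := by
    intro t ht ht1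
    refine Summable.of_norm_bounded ((summable_geometric_of_lt_one hq0.le hq1).mul_left
      (4 * C * ((2 ^ 0)⁻¹ : ℝ) ^ β)) fun i => ?_
    have := abs_dyadicStep_add_sub_le hβ0 hC0 hC le_rfl ht 0 (by simpa using ht1) i
    rwa [add_zero, hstep0, sub_zero] at this
  have hsum : ∀ t, 0 ≤ t → ∀ n, dyadicSum (R 0) n t =
      dyadicSum (R 0) 0 t + ∑ i ∈ Finset.range n, dyadicStep R i t := by
    intro t ht n
    induction n with
    | zero => simp
    | succ n ih => rw [dyadicSum_succ hR h0 n ht, ih, Finset.sum_range_succ, add_assoc]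
  refine ⟨fun t => dyadicSum (R 0) 0 t + ∑' n, dyadicStep R n t,
    (2 * C + 4 * C * (1 - q)⁻¹) * 2 ^ β, fun s t hs hst ht => ?_⟩
  rcases hst.eq_or_lt with rfl | hlt
  · simp [degenerate_right hR h0, Real.zero_rpow (show β ≠ 0 by linarith)]
  obtain ⟨n, hn1, hn2⟩ := exists_nat_pow_near_of_lt_one (sub_pos.2 hlt) (by linarith)
    (show (0 : ℝ) < 2⁻¹ by norm_num) (by norm_num)
  rw [inv_pow] at hn1 hn2
  have hh : ((2 : ℝ) ^ n)⁻¹ ≤ 2 * |t - s| := by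
    rw [abs_of_pos (sub_pos.2 hlt)]
    rw [pow_succ, mul_inv] at hn1
    linarith
  have hhβ : (((2 : ℝ) ^ n)⁻¹) ^ β ≤ 2 ^ β * |t - s| ^ β := by
    rw [← Real.mul_rpow (by norm_num) (abs_nonneg _)]
    gcongr
  have b1 := abs_dyadicSum_sub_le hR n (abs_le_mesh hβ0 hC0 hC n) hs hst (by linarith)
  have b2 : |∑' i, dyadicStep R (i + n) t - ∑' i, dyadicStep R (i + n) s| ≤
      4 * C * ((2 ^ n)⁻¹ : ℝ) ^ β * (1 - q)⁻¹ := by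
    rw [← Summable.tsum_sub ((summable_nat_add_iff n).2 (hsummable t (hs.trans hst) ht))
      ((summable_nat_add_iff n).2 (hsummable s hs (hst.trans ht)))]
    exact tsum_of_norm_bounded (f := fun i => dyadicStep R (i + n) t - dyadicStep R (i + n) s)
      ((hasSum_geometric_of_lt_one hq0.le hq1).mul_left (4 * C * ((2 ^ n)⁻¹ : ℝ) ^ β))
      (abs_dyadicStep_add_sub_le hβ0 hC0 hC hs hst n hn2)
  have e : dyadicSum (R 0) 0 t + ∑' n, dyadicStep R n t
      - (dyadicSum (R 0) 0 s + ∑' n, dyadicStep R n s) - R 0 s t =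
      (dyadicSum (R 0) n t - dyadicSum (R 0) n s - R 0 s t) +
      (∑' i, dyadicStep R (i + n) t - ∑' i, dyadicStep R (i + n) s) := by
    rw [hsum t (hs.trans hst) n, hsum s hs n,
      ← (hsummable t (hs.trans hst) ht).sum_add_tsum_nat_add n,
      ← (hsummable s hs (hst.trans ht)).sum_add_tsum_nat_add n]
    ring
  rw [e]
  have hq2 : 0 ≤ (1 - q)⁻¹ := inv_nonneg.2 (by linarith)
  calc _ ≤ 2 * (C * (((2 : ℝ) ^ n)⁻¹) ^ β) + 4 * C * ((2 ^ n)⁻¹ : ℝ) ^ β * (1 - q)⁻¹ :=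
        (abs_add_le _ _).trans (add_le_add b1 b2)
    _ = (2 * C + 4 * C * (1 - q)⁻¹) * (((2 : ℝ) ^ n)⁻¹) ^ β := by ring
    _ ≤ (2 * C + 4 * C * (1 - q)⁻¹) * (2 ^ β * |t - s| ^ β) := by gcongr
    _ = _ := by ring

end Sewing

/-- **Sewing lemma.** A cocycle of order `β > 1` is the defect of additivity of a function of the
same order. -/
theorem exists_sewing {T : ℝ} (hT : 0 < T) {β C : ℝ} (hβ : 1 < β)
    {R : Set.Icc (0 : ℝ) T → Set.Icc (0 : ℝ) T → Set.Icc (0 : ℝ) T → ℝ}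
    (hR : ∀ r s u t, R r s u + R r u t = R s u t + R r s t)
    (hC : ∀ s u t, |R s u t| ≤ C * max |(u : ℝ) - s| |(t : ℝ) - u| ^ β) :
    ∃ F : Set.Icc (0 : ℝ) T → Set.Icc (0 : ℝ) T → ℝ,
      (∀ s u t, F s t = F s u + F u t + R s u t) ∧ ∃ K : ℝ, ∀ s t,
        |F s t| ≤ K * |(t : ℝ) - s| ^ β := by
  have hβ0 : 0 ≤ β := by linarith
  have hC0 : 0 ≤ C := by
    have := (abs_nonneg _).trans (hC ⟨0, by simp [hT.le]⟩ ⟨0, by simp [hT.le]⟩ ⟨T, by simp [hT.le]⟩)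
    refine nonneg_of_mul_nonneg_left this (Real.rpow_pos_of_pos ?_ _)
    simp [hT.ne']
  -- Rescale time to the unit interval and extend constantly.
  set c : ℝ → Set.Icc (0 : ℝ) T := fun x => Set.projIcc 0 T hT.le (T * x) with hc
  have hcd : ∀ x y, |(c x : ℝ) - c y| ≤ T * |x - y| := by
    intro x y
    refine (Set.abs_projIcc_sub_projIcc hT.le).trans ?_
    rw [← mul_sub, abs_mul, abs_of_pos hT]
  have hcT : ∀ t : Set.Icc (0 : ℝ) T, c (t / T) = t := by
    intro t
    rw [hc]
    simp only
    rw [mul_div_cancel₀ _ hT.ne', Set.projIcc_val]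
  obtain ⟨j, K, hj⟩ := Sewing.exists_of_unit (R := fun s u t => R (c s) (c u) (c t)) (β := β)
    (C := C * T ^ β) hβ (fun r s u t => hR _ _ _ _) (by
      intro s u t
      refine (hC _ _ _).trans ?_
      rw [mul_assoc, ← Real.mul_rpow hT.le (by positivity), mul_max_of_nonneg _ _ hT.le]
      gcongr <;> exact hcd _ _)
  have hR0 : ∀ s, R s s s = 0 := by
    intro s
    have := hC s s s
    rw [sub_self, abs_zero, max_self, Real.zero_rpow (by linarith), mul_zero] at this
    exact abs_nonpos_iff.1 this
  set F : Set.Icc (0 : ℝ) T → Set.Icc (0 : ℝ) T → ℝ :=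
    fun s t => j (t / T) - j (s / T) - R (c 0) s t with hF
  have hFadd : ∀ s u t, F s t = F s u + F u t + R s u t := by
    intro s u t
    have := hR (c 0) s u t
    simp only [hF]
    linarith
  have hFle : ∀ s t, s ≤ t → |F s t| ≤ K * T⁻¹ ^ β * |(t : ℝ) - s| ^ β := by
    intro s t hst
    have h := hj (s / T) (t / T) (div_nonneg s.2.1 hT.le)
      (by gcongr) ((div_le_one hT).2 t.2.2)
    simp only [hcT] at h
    refine h.trans (le_of_eq ?_)
    rw [← sub_div, abs_div, abs_of_pos hT, div_eq_inv_mul,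
      Real.mul_rpow (inv_nonneg.2 hT.le) (abs_nonneg _), mul_assoc]
  refine ⟨F, hFadd, K * T⁻¹ ^ β + C, fun s t => ?_⟩
  have hpos : 0 ≤ |(t : ℝ) - s| ^ β := by positivity
  rcases le_total s t with hst | hst
  · have := hFle s t hst
    nlinarith
  · -- For `t ≤ s`, compare with the value at `(t, s)` through the loop from `s` to `t` and back.
    have h1 := hFle t s hst
    have h2 := hFadd s t s
    have h3 := hFadd s s s
    have h4 := hC s t s
    rw [abs_sub_comm (s : ℝ) t] at h1 h4
    rw [max_self] at h4
    rw [hR0] at h3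
    rw [abs_le] at *
    constructor <;> nlinarith

/-- An additive function of two times which is of order larger than one vanishes. -/
theorem eq_zero_of_additive {T : ℝ} {β C : ℝ} (hβ : 1 < β)
    {D : Set.Icc (0 : ℝ) T → Set.Icc (0 : ℝ) T → ℝ} (hD : ∀ s u t, D s t = D s u + D u t)
    (hC : ∀ s t, |D s t| ≤ C * |(t : ℝ) - s| ^ β) (s t : Set.Icc (0 : ℝ) T) : D s t = 0 := by
  have hβ0 : 0 ≤ β := by linarith
  set q : ℝ := 2 ^ (1 - β) with hq
  have hq0 : 0 < q := by positivity
  have hq1 : q < 1 := Real.rpow_lt_one_of_one_lt_of_neg (by norm_num) (by linarith)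
  -- Splitting an interval at its midpoint improves the constant by the factor `q < 1`.
  have key : ∀ n : ℕ, ∀ s t : Set.Icc (0 : ℝ) T, |D s t| ≤ C * q ^ n * |(t : ℝ) - s| ^ β := by
    intro n
    induction n with
    | zero => simpa using hC
    | succ n ih =>
      intro s t
      have hs := s.2
      have ht := t.2
      simp only [Set.mem_Icc] at hs ht
      set u : Set.Icc (0 : ℝ) T := ⟨((s : ℝ) + t) / 2, by constructor <;> linarith⟩ with hu
      have e1 : |(u : ℝ) - s| = 2⁻¹ * |(t : ℝ) - s| := by
        rw [show (u : ℝ) - s = 2⁻¹ * (t - s) by simp only [hu]; ring, abs_mul]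
        norm_num
      have e2 : |(t : ℝ) - u| = 2⁻¹ * |(t : ℝ) - s| := by
        rw [show (t : ℝ) - u = 2⁻¹ * (t - s) by simp only [hu]; ring, abs_mul]
        norm_num
      have h1 := ih s u
      have h2 := ih u t
      rw [e1] at h1
      rw [e2] at h2
      have e3 : q = 2 * (2⁻¹ : ℝ) ^ β := by
        rw [hq, Real.rpow_sub (by norm_num), Real.rpow_one, Real.inv_rpow (by norm_num),
          div_eq_mul_inv]
      calc |D s t| ≤ |D s u| + |D u t| := by rw [hD s u t]; exact abs_add_le _ _
        _ ≤ 2 * (C * q ^ n * (2⁻¹ * |(t : ℝ) - s|) ^ β) := by linarith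
        _ = 2 * (C * q ^ n * ((2⁻¹ : ℝ) ^ β * |(t : ℝ) - s| ^ β)) := by
          rw [Real.mul_rpow (by norm_num) (abs_nonneg _)]
        _ = C * q ^ (n + 1) * |(t : ℝ) - s| ^ β := by rw [pow_succ, ← mul_assoc C, e3]; ring
  have hlim : Filter.Tendsto (fun n : ℕ => C * q ^ n * |(t : ℝ) - s| ^ β) Filter.atTop
      (nhds (C * 0 * |(t : ℝ) - s| ^ β)) :=
    ((tendsto_pow_atTop_nhds_zero_of_lt_one hq0.le hq1).const_mul C).mul_const _
  rw [mul_zero, zero_mul] at hlim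
  exact abs_nonpos_iff.1 (ge_of_tendsto' hlim fun n => key n s t)

section Extension

variable {A : Type*} {T : ℝ} {α : ℝ≥0}

/-! ### Branched rough paths as families of characters -/

/-- The character with prescribed values on trees, as a linear functional. -/
abbrev characterLin (φ : Tree A → ℝ) : CK A →ₗ[ℝ] ℝ := (character φ).toLinearMap

theorem characterLin_one (φ : Tree A → ℝ) : characterLin φ 1 = 1 := map_one (character φ)

theorem characterLin_mul (φ : Tree A → ℝ) (u v : CK A) :
    characterLin φ (u * v) = characterLin φ u * characterLin φ v := map_mul (character φ) u v

theorem characterLin_single (φ : Tree A → ℝ) (τ : Tree A) :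
    characterLin φ (forest (Finsupp.single τ 1)) = φ τ := character_X φ τ

theorem convolution_characterLin_one (φ ψ : Tree A → ℝ) :
    convolution (characterLin φ) (characterLin ψ) 1 = 1 := by
  rw [convolution_one, characterLin_one, characterLin_one, one_mul]

theorem characterLin_forest_congr {φ ψ : Tree A → ℝ} {n : ℕ}
    (h : ∀ τ, τ.degree ≤ n → φ τ = ψ τ) (m : Tree A →₀ ℕ) (hm : forestDegree m ≤ n) :
    characterLin φ (forest m) = characterLin ψ (forest m) := by
  refine eq_on_forest_of_eq_on_tree (N := n) (characterLin_one _) (characterLin_one _)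
    (fun _ _ _ => characterLin_mul _ _ _) (fun _ _ _ => characterLin_mul _ _ _) (fun τ hτ => ?_) m
    (by exact_mod_cast hm)
  rw [← forest_single, characterLin_single, characterLin_single]
  exact h τ (by exact_mod_cast hτ)

/-- A family of values on trees, indexed by two times, satisfies Chen's relation and the Hölder
bounds on the trees with at most `n` vertices. -/
structure IsRoughUpTo (α : ℝ≥0) (n : ℕ)
    (φ : Set.Icc (0 : ℝ) T → Set.Icc (0 : ℝ) T → Tree A → ℝ) : Prop where
  chen : ∀ τ : Tree A, τ.degree ≤ n → ∀ s u t, φ s t τ = φ s u τ + φ u t τ +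
    tensorPair (characterLin (φ s u)) (characterLin (φ u t))
      (reducedCoproduct (Finsupp.single τ 1))
  holder : ∀ τ : Tree A, τ.degree ≤ n → ∃ C : ℝ, ∀ s t,
    |φ s t τ| ≤ C * |(t : ℝ) - s| ^ ((α : ℝ) * τ.degree)

variable {φ ψ : Set.Icc (0 : ℝ) T → Set.Icc (0 : ℝ) T → Tree A → ℝ} {n : ℕ}

theorem reducedCoproduct_single_mem (τ : Tree A) :
    reducedCoproduct (Finsupp.single τ 1) ∈ reducedSpan A τ.degree := by
  have := reducedCoproduct_mem (Finsupp.single τ 1) (by simp)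
  rwa [forestDegree_single] at this

theorem tensorPair_reducedCoproduct_congr {φ φ' ψ ψ' : Tree A → ℝ} (τ : Tree A)
    (hφ : ∀ σ, σ.degree < τ.degree → φ σ = φ' σ) (hψ : ∀ σ, σ.degree < τ.degree → ψ σ = ψ' σ) :
    tensorPair (characterLin φ) (characterLin ψ) (reducedCoproduct (Finsupp.single τ 1)) =
      tensorPair (characterLin φ') (characterLin ψ') (reducedCoproduct (Finsupp.single τ 1)) := by
  have := τ.degree_pos
  exact tensorPair_congr (n := τ.degree)
    (fun m hm => characterLin_forest_congr (n := τ.degree - 1) (fun σ hσ => hφ σ (by omega)) m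
      (by omega))
    (fun m hm => characterLin_forest_congr (n := τ.degree - 1) (fun σ hσ => hψ σ (by omega)) m
      (by omega))
    (reducedCoproduct_single_mem τ)

theorem IsRoughUpTo.mono {k : ℕ} (hφ : IsRoughUpTo α n φ) (h : k ≤ n) : IsRoughUpTo α k φ :=
  ⟨fun τ hτ => hφ.chen τ (hτ.trans h), fun τ hτ => hφ.holder τ (hτ.trans h)⟩

theorem IsRoughUpTo.chen_forest (hφ : IsRoughUpTo α n φ) (s u t : Set.Icc (0 : ℝ) T)
    (m : Tree A →₀ ℕ) (hm : forestDegree m ≤ n) : characterLin (φ s t) (forest m) =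
      convolution (characterLin (φ s u)) (characterLin (φ u t)) (forest m) := by
  refine eq_on_forest_of_eq_on_tree (N := n) (characterLin_one _)
    (convolution_characterLin_one _ _) (fun _ _ _ => characterLin_mul _ _ _)
    (fun _ _ _ => convolution_mul _ _ _ _) (fun τ hτ => ?_) m (by exact_mod_cast hm)
  rw [← forest_single, convolution_forest _ _ (characterLin_one _) (characterLin_one _)]
  simp only [characterLin_single]
  exact hφ.chen τ (by exact_mod_cast hτ) s u t

theorem IsRoughUpTo.holder_forest (hφ : IsRoughUpTo α n φ) (m : Tree A →₀ ℕ) :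
    forestDegree m ≤ n → ∃ C : ℝ, 0 ≤ C ∧ ∀ s t, |characterLin (φ s t) (forest m)| ≤
      C * |(t : ℝ) - s| ^ ((α : ℝ) * forestDegree m) := by
  induction m using forest_induction_tree with
  | zero => exact fun _ => ⟨1, by simp, fun s t => by simp [forest_zero]⟩
  | tree τ =>
    intro h
    obtain ⟨C, hC⟩ := hφ.holder τ (by simpa using h)
    refine ⟨|C|, abs_nonneg C, fun s t => ?_⟩
    rw [characterLin_single, forestDegree_single]
    refine (hC s t).trans ?_
    gcongr
    exact le_abs_self C
  | add m k hm hk =>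
    intro h
    rw [forestDegree_add] at h
    obtain ⟨C, hC0, hC⟩ := hm (by omega)
    obtain ⟨D, hD0, hD⟩ := hk (by omega)
    refine ⟨C * D, mul_nonneg hC0 hD0, fun s t => ?_⟩
    rw [forest_add, characterLin_mul, abs_mul, forestDegree_add, Nat.cast_add, mul_add,
      Real.rpow_add_of_nonneg (abs_nonneg _) (by positivity) (by positivity)]
    calc _ ≤ (C * |(t : ℝ) - s| ^ ((α : ℝ) * forestDegree m)) *
          (D * |(t : ℝ) - s| ^ ((α : ℝ) * forestDegree k)) := by
          gcongr
          · exact hC s t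
          · exact hD s t
      _ = _ := by ring

theorem IsRoughUpTo.abs_tensorPair_le (hφ : IsRoughUpTo α n φ) {y : CK A ⊗[ℝ] CK A}
    (hy : y ∈ reducedSpan A (n + 1)) :
    ∃ C : ℝ, ∀ s u t, |tensorPair (characterLin (φ s u)) (characterLin (φ u t)) y| ≤
      C * max |(u : ℝ) - s| |(t : ℝ) - u| ^ ((α : ℝ) * (n + 1 : ℕ)) := by
  induction hy using Submodule.span_induction with
  | zero => exact ⟨0, fun s u t => by simp⟩
  | add y z _ _ hy hz =>
    obtain ⟨C, hC⟩ := hy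
    obtain ⟨D, hD⟩ := hz
    refine ⟨C + D, fun s u t => ?_⟩
    rw [map_add, add_mul]
    exact (abs_add_le _ _).trans (add_le_add (hC s u t) (hD s u t))
  | smul c y _ hy =>
    obtain ⟨C, hC⟩ := hy
    refine ⟨|c| * C, fun s u t => ?_⟩
    rw [map_smul, smul_eq_mul, abs_mul, mul_assoc]
    exact mul_le_mul_of_nonneg_left (hC s u t) (abs_nonneg c)
  | mem y hy =>
    obtain ⟨a, b, ha, hb, hab, rfl⟩ := hy
    have ha' := forestDegree_pos ha
    have hb' := forestDegree_pos hb
    obtain ⟨C, hC0, hC⟩ := hφ.holder_forest a (by omega)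
    obtain ⟨D, hD0, hD⟩ := hφ.holder_forest b (by omega)
    refine ⟨C * D, fun s u t => ?_⟩
    rw [tensorPair_tmul, abs_mul, ← hab, Nat.cast_add, mul_add,
      Real.rpow_add_of_nonneg (by positivity) (by positivity) (by positivity)]
    set M := max |(u : ℝ) - s| |(t : ℝ) - u|
    have hM1 : |(u : ℝ) - s| ≤ M := le_max_left _ _
    have hM2 : |(t : ℝ) - u| ≤ M := le_max_right _ _
    calc _ ≤ (C * M ^ ((α : ℝ) * forestDegree a)) * (D * M ^ ((α : ℝ) * forestDegree b)) := by
          gcongr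
          · refine (hC s u).trans ?_
            gcongr
          · refine (hD u t).trans ?_
            gcongr
      _ = _ := by ring

/-- The terms of Chen's relation in degree `n + 1` which are already determined by the degrees up to
`n` form a cocycle, by coassociativity. -/
theorem IsRoughUpTo.cocycle (hφ : IsRoughUpTo α n φ) {τ : Tree A} (hτ : τ.degree = n + 1)
    (r s u t : Set.Icc (0 : ℝ) T) :
    tensorPair (characterLin (φ r s)) (characterLin (φ s u))
        (reducedCoproduct (Finsupp.single τ 1)) +
      tensorPair (characterLin (φ r u)) (characterLin (φ u t))
        (reducedCoproduct (Finsupp.single τ 1)) =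
    tensorPair (characterLin (φ s u)) (characterLin (φ u t))
        (reducedCoproduct (Finsupp.single τ 1)) +
      tensorPair (characterLin (φ r s)) (characterLin (φ s t))
        (reducedCoproduct (Finsupp.single τ 1)) := by
  have h := LinearMap.congr_fun (convolution_assoc (characterLin (φ r s)) (characterLin (φ s u))
    (characterLin (φ u t))) (forest (Finsupp.single τ 1))
  have hmem := reducedCoproduct_single_mem τ
  rw [hτ] at hmem
  rw [convolution_forest _ _ (convolution_characterLin_one _ _) (characterLin_one _),
    convolution_forest _ _ (characterLin_one _) (convolution_characterLin_one _ _),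
    convolution_forest _ _ (characterLin_one _) (characterLin_one _),
    convolution_forest _ _ (characterLin_one _) (characterLin_one _),
    tensorPair_congr (f' := characterLin (φ r u)) (g' := characterLin (φ u t))
      (fun m hm => (hφ.chen_forest r s u m (by omega)).symm) (fun _ _ => rfl) hmem,
    tensorPair_congr (f := characterLin (φ r s)) (f' := characterLin (φ r s))
      (g' := characterLin (φ s t)) (fun _ _ => rfl)
      (fun m hm => (hφ.chen_forest s u t m (by omega)).symm) hmem] at h
  linarith

theorem IsRoughUpTo.congr (hφ : IsRoughUpTo α n φ)
    (h : ∀ τ : Tree A, τ.degree ≤ n → ∀ s t, ψ s t τ = φ s t τ) : IsRoughUpTo α n ψ where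
  chen τ hτ s u t := by
    rw [h τ hτ, h τ hτ, h τ hτ, hφ.chen τ hτ s u t, tensorPair_reducedCoproduct_congr τ
      (fun σ hσ => (h σ (by omega) s u).symm) (fun σ hσ => (h σ (by omega) u t).symm)]
  holder τ hτ := by
    simp only [h τ hτ]
    exact hφ.holder τ hτ

/-! ### Extension and uniqueness -/

/-- A rough path can be extended by one degree `n + 1` with `α (n + 1) > 1`. -/
theorem IsRoughUpTo.exists_succ (hT : 0 < T) (hφ : IsRoughUpTo α n φ)
    (hα : 1 < (α : ℝ) * (n + 1 : ℕ)) :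
    ∃ ψ : Set.Icc (0 : ℝ) T → Set.Icc (0 : ℝ) T → Tree A → ℝ,
      IsRoughUpTo α (n + 1) ψ ∧ ∀ τ : Tree A, τ.degree ≤ n → ∀ s t, ψ s t τ = φ s t τ := by
  have hsew : ∀ τ : Tree A, τ.degree = n + 1 → ∃ F : Set.Icc (0 : ℝ) T → Set.Icc (0 : ℝ) T → ℝ,
      (∀ s u t, F s t = F s u + F u t + tensorPair (characterLin (φ s u)) (characterLin (φ u t))
        (reducedCoproduct (Finsupp.single τ 1))) ∧
      ∃ K : ℝ, ∀ s t, |F s t| ≤ K * |(t : ℝ) - s| ^ ((α : ℝ) * (n + 1 : ℕ)) := by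
    intro τ hτ
    have hmem := reducedCoproduct_single_mem τ
    rw [hτ] at hmem
    obtain ⟨C, hC⟩ := hφ.abs_tensorPair_le hmem
    exact exists_sewing hT hα (hφ.cocycle hτ) hC
  choose F hF K hK using hsew
  set ψ : Set.Icc (0 : ℝ) T → Set.Icc (0 : ℝ) T → Tree A → ℝ :=
    fun s t τ => if h : τ.degree = n + 1 then F τ h s t else φ s t τ with hψ
  have hlow : ∀ τ : Tree A, τ.degree ≤ n → ∀ s t, ψ s t τ = φ s t τ := by
    intro τ hτ s t
    exact dif_neg (by omega)
  have htop : ∀ (τ : Tree A) (h : τ.degree = n + 1) (s t), ψ s t τ = F τ h s t := by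
    intro τ h s t
    exact dif_pos h
  have hψn := hφ.congr hlow
  refine ⟨ψ, ⟨fun τ hτ s u t => ?_, fun τ hτ => ?_⟩, hlow⟩
  · rcases Nat.le_succ_iff.1 hτ with h | h
    · exact hψn.chen τ h s u t
    · rw [htop τ h, htop τ h, htop τ h, hF τ h s u t, tensorPair_reducedCoproduct_congr τ
        (fun σ hσ => (hlow σ (by omega) s u).symm) (fun σ hσ => (hlow σ (by omega) u t).symm)]
  · rcases Nat.le_succ_iff.1 hτ with h | h
    · exact hψn.holder τ h
    · refine ⟨K τ h, fun s t => ?_⟩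
      rw [htop τ h, h]
      exact hK τ h s t

/-- A rough path can be extended to all degrees. -/
theorem IsRoughUpTo.exists_extension (hT : 0 < T) {p : ℕ} (hφ : IsRoughUpTo α p φ)
    (hα : 1 < (α : ℝ) * (p + 1 : ℕ)) :
    ∃ ψ : Set.Icc (0 : ℝ) T → Set.Icc (0 : ℝ) T → Tree A → ℝ,
      (∀ n, IsRoughUpTo α n ψ) ∧ ∀ τ : Tree A, τ.degree ≤ p → ∀ s t, ψ s t τ = φ s t τ := by
  have hα' : ∀ k : ℕ, 1 < (α : ℝ) * (p + k + 1 : ℕ) := by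
    intro k
    refine hα.trans_le ?_
    gcongr
    omega
  have hstep : ∀ (k : ℕ) (ψ : {ψ : Set.Icc (0 : ℝ) T → Set.Icc (0 : ℝ) T → Tree A → ℝ //
      IsRoughUpTo α (p + k) ψ}), ∃ χ : {χ : Set.Icc (0 : ℝ) T → Set.Icc (0 : ℝ) T → Tree A → ℝ //
      IsRoughUpTo α (p + (k + 1)) χ},
      ∀ τ : Tree A, τ.degree ≤ p + k → ∀ s t, χ.1 s t τ = ψ.1 s t τ := by
    intro k ψ
    obtain ⟨χ, hχ, h⟩ := ψ.2.exists_succ hT (hα' k)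
    exact ⟨⟨χ, hχ⟩, h⟩
  choose next hnext using hstep
  set seq : ∀ k : ℕ, {ψ : Set.Icc (0 : ℝ) T → Set.Icc (0 : ℝ) T → Tree A → ℝ //
      IsRoughUpTo α (p + k) ψ} := fun k => Nat.rec ⟨φ, hφ⟩ next k with hseq
  have hstable : ∀ k l : ℕ, k ≤ l → ∀ τ : Tree A, τ.degree ≤ p + k → ∀ s t,
      (seq l).1 s t τ = (seq k).1 s t τ := by
    intro k l hkl
    induction l, hkl using Nat.le_induction with
    | base => exact fun _ _ _ _ => rfl
    | succ l hkl ih =>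
      intro τ hτ s t
      rw [← ih τ hτ s t]
      exact hnext l (seq l) τ (by omega) s t
  have heq : ∀ (n : ℕ) (τ : Tree A), τ.degree ≤ n → ∀ s t,
      (seq τ.degree).1 s t τ = (seq n).1 s t τ := fun n τ hτ s t =>
    (hstable τ.degree n hτ τ (by omega) s t).symm
  refine ⟨fun s t τ => (seq τ.degree).1 s t τ, fun n => ?_, fun τ hτ s t => ?_⟩
  · exact ((seq n).2.mono (by omega)).congr (heq n)
  · exact hstable 0 τ.degree (Nat.zero_le _) τ hτ s t

/-- A rough path is determined by its values on intervals starting at time `0`. -/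
theorem IsRoughUpTo.eq_of_eq_start (hφ : IsRoughUpTo α n φ) (hψ : IsRoughUpTo α n ψ)
    {o : Set.Icc (0 : ℝ) T} (h : ∀ τ : Tree A, τ.degree ≤ n → ∀ t, φ o t τ = ψ o t τ)
    (τ : Tree A) (hτ : τ.degree ≤ n) (s t : Set.Icc (0 : ℝ) T) : φ s t τ = ψ s t τ := by
  induction hk : τ.degree using Nat.strong_induction_on generalizing τ s t with
  | _ k ih =>
    have h1 := hφ.chen τ hτ o s t
    have h2 := hψ.chen τ hτ o s t
    rw [tensorPair_reducedCoproduct_congr (φ' := ψ o s) (ψ' := ψ s t) τ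
      (fun σ hσ => h σ (by omega) s) (fun σ hσ => ih σ.degree (by omega) σ (by omega) s t rfl),
      h τ hτ, h τ hτ] at h1
    linarith

/-- A rough path is determined by its values in the degrees `k` with `α k ≤ 1`. -/
theorem IsRoughUpTo.eq_of_eq_low {p : ℕ} (hφ : IsRoughUpTo α n φ) (hψ : IsRoughUpTo α n ψ)
    (hα : 1 < (α : ℝ) * (p + 1 : ℕ)) (h : ∀ τ : Tree A, τ.degree ≤ p → ∀ s t, φ s t τ = ψ s t τ)
    (τ : Tree A) (hτ : τ.degree ≤ n) (s t : Set.Icc (0 : ℝ) T) : φ s t τ = ψ s t τ := by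
  induction hk : τ.degree using Nat.strong_induction_on generalizing τ s t with
  | _ k ih =>
    rcases le_or_gt τ.degree p with hp | hp
    · exact h τ hp s t
    obtain ⟨C, hC⟩ := hφ.holder τ hτ
    obtain ⟨D, hD⟩ := hψ.holder τ hτ
    have hβ : 1 < (α : ℝ) * τ.degree := hα.trans_le (by gcongr; omega)
    refine sub_eq_zero.1 (eq_zero_of_additive (D := fun s t => φ s t τ - ψ s t τ) (C := C + D) hβ
      (fun s u t => ?_) (fun s t => ?_) s t)
    · have h1 := hφ.chen τ hτ s u t
      have h2 := hψ.chen τ hτ s u t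
      rw [tensorPair_reducedCoproduct_congr (φ' := ψ s u) (ψ' := ψ u t) τ
        (fun σ hσ => ih σ.degree (by omega) σ (by omega) s u rfl)
        (fun σ hσ => ih σ.degree (by omega) σ (by omega) u t rfl)] at h1
      linarith
    · rw [add_mul]
      exact (abs_sub _ _).trans (add_le_add (hC s t) (hD s t))

/-! ### Comparison with the Butcher groups -/

/-- The values of an element of a Butcher group on trees. -/
def ButcherGroup.onTrees {N : ℕ∞} (g : ButcherGroup A N) (τ : Tree A) : ℝ :=
  g.pair (MvPolynomial.X τ)

theorem ButcherGroup.pair_forest {N : ℕ∞} (g : ButcherGroup A N) (m : Tree A →₀ ℕ)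
    (hm : (forestDegree m : ℕ∞) ≤ N) : g.pair (forest m) = characterLin g.onTrees (forest m) :=
  eq_on_forest_of_eq_on_tree g.pair_one (characterLin_one _) g.pair_mul
    (fun _ _ _ => characterLin_mul _ _ _) (fun τ _ => (character_X g.onTrees τ).symm) m hm

theorem ButcherGroup.pair_eq_characterLin (g : ButcherGroup A ⊤) :
    g.pair = characterLin g.onTrees :=
  CK.linearMap_ext fun m => g.pair_forest m le_top

/-- The element of the full Butcher group with prescribed values on trees. -/
def ButcherGroup.ofTrees (φ : Tree A → ℝ) : ButcherGroup A ⊤ where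
  pair := characterLin φ
  pair_one := characterLin_one φ
  pair_mul _ _ _ := characterLin_mul φ _ _
  pair_eq_zero _ h := absurd h not_top_lt

theorem ButcherGroup.ext_onTrees {g h : ButcherGroup A ⊤} (e : ∀ τ, g.onTrees τ = h.onTrees τ) :
    g = h := by
  ext1
  rw [g.pair_eq_characterLin, h.pair_eq_characterLin, funext e]

theorem IsBranchedRoughPath.isRoughUpTo {N : ℕ∞}
    {Z : Set.Icc (0 : ℝ) T → Set.Icc (0 : ℝ) T → ButcherGroup A N}
    (hZ : IsBranchedRoughPath α Z) {n : ℕ} (hn : (n : ℕ∞) ≤ N) :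
    IsRoughUpTo α n fun s t => (Z s t).onTrees where
  chen τ hτ s u t := by
    have hN : (τ.degree : ℕ∞) ≤ N := le_trans (by exact_mod_cast hτ) hn
    have h := hZ.chen s u t (Finsupp.single τ 1) (by rwa [forestDegree_single])
    rw [convolution_forest _ _ (Z s u).pair_one (Z u t).pair_one,
      tensorPair_congr (f' := characterLin (Z s u).onTrees) (g' := characterLin (Z u t).onTrees)
        (fun m hm => (Z s u).pair_forest m (le_trans (by exact_mod_cast hm.le) hN))
        (fun m hm => (Z u t).pair_forest m (le_trans (by exact_mod_cast hm.le) hN))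
        (reducedCoproduct_single_mem τ)] at h
    exact h
  holder τ hτ := by
    have hN : (τ.degree : ℕ∞) ≤ N := le_trans (by exact_mod_cast hτ) hn
    have h := hZ.holder (Finsupp.single τ 1) (by rwa [forestDegree_single])
    rwa [forestDegree_single] at h

theorem isBranchedRoughPath_ofTrees (h : ∀ n, IsRoughUpTo α n φ) :
    IsBranchedRoughPath α fun s t => ButcherGroup.ofTrees (φ s t) where
  chen s u t m _ := (h (forestDegree m)).chen_forest s u t m le_rfl
  holder m _ := by
    obtain ⟨C, -, hC⟩ := (h (forestDegree m)).holder_forest m le_rfl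
    exact ⟨C, hC⟩

variable {d p : ℕ} {hT : 0 < T} {x : C(Set.Icc (0 : ℝ) T, ButcherGroup (Fin (d + 1)) p)}
  {B B' : Set.Icc (0 : ℝ) T → Set.Icc (0 : ℝ) T → ButcherGroup (Fin (d + 1)) ⊤}
  {Z : Set.Icc (0 : ℝ) T → Set.Icc (0 : ℝ) T → ButcherGroup (Fin (d + 1)) p}

theorem IsBranchedSignature.onTrees_eq (hB : IsBranchedSignature hT α x B)
    (hZ : IsBranchedRoughPath α Z) (hx : ∀ t, x t = Z ⟨0, Set.left_mem_Icc.2 hT.le⟩ t)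
    (τ : Tree (Fin (d + 1))) (hτ : τ.degree ≤ p) (s t : Set.Icc (0 : ℝ) T) :
    (B s t).onTrees τ = (Z s t).onTrees τ := by
  refine (hB.isBranchedRoughPath.isRoughUpTo (n := p) le_top).eq_of_eq_start
    (hZ.isRoughUpTo le_rfl) (o := ⟨0, Set.left_mem_Icc.2 hT.le⟩) (fun σ hσ t => ?_) τ hτ s t
  rw [← hx]
  exact hB.extends_path t (Finsupp.single σ 1) (by rwa [forestDegree_single])

theorem IsBranchedSignature.pair_forest_eq (hB : IsBranchedSignature hT α x B)
    (hZ : IsBranchedRoughPath α Z) (hx : ∀ t, x t = Z ⟨0, Set.left_mem_Icc.2 hT.le⟩ t)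
    (m : Tree (Fin (d + 1)) →₀ ℕ) (hm : forestDegree m ≤ p) (s t : Set.Icc (0 : ℝ) T) :
    (B s t).pair (forest m) = (Z s t).pair (forest m) := by
  rw [(B s t).pair_forest m le_top, (Z s t).pair_forest m (by exact_mod_cast hm)]
  exact characterLin_forest_congr (fun τ hτ => hB.onTrees_eq hZ hx τ hτ s t) m hm

/-- The path above a level-`p` rough path has exactly one branched signature if `α (p + 1) > 1`. -/
theorem existsUnique_isBranchedSignature (hα : 1 < (α : ℝ) * (p + 1 : ℕ))
    (hZ : IsBranchedRoughPath α Z) (hx : ∀ t, x t = Z ⟨0, Set.left_mem_Icc.2 hT.le⟩ t) :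
    ∃! B : Set.Icc (0 : ℝ) T → Set.Icc (0 : ℝ) T → ButcherGroup (Fin (d + 1)) ⊤,
      IsBranchedSignature hT α x B := by
  obtain ⟨ψ, hψ, hψZ⟩ := (hZ.isRoughUpTo (n := p) le_rfl).exists_extension hT hα
  refine existsUnique_of_exists_of_unique
    ⟨fun s t => ButcherGroup.ofTrees (ψ s t), isBranchedRoughPath_ofTrees hψ, fun t m hm => ?_⟩ ?_
  · rw [hx, (Z _ t).pair_forest m (by exact_mod_cast hm)]
    exact characterLin_forest_congr (fun τ hτ => hψZ τ hτ _ t) m hm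
  · intro B B' hB hB'
    ext1 s
    ext1 t
    refine ButcherGroup.ext_onTrees fun τ => ?_
    exact (hB.isBranchedRoughPath.isRoughUpTo (n := τ.degree) le_top).eq_of_eq_low
      (hB'.isBranchedRoughPath.isRoughUpTo le_top) hα
      (fun σ hσ s t => (hB.onTrees_eq hZ hx σ hσ s t).trans (hB'.onTrees_eq hZ hx σ hσ s t).symm)
      τ le_rfl s t

end Extension

section TimeIntegral

/-! ### Integrals against time -/

section Continuity

variable {A : Type*} {T : ℝ} {α : ℝ≥0}
  {B : Set.Icc (0 : ℝ) T → Set.Icc (0 : ℝ) T → ButcherGroup A ⊤}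

theorem IsBranchedRoughPath.convolution_eq (hB : IsBranchedRoughPath α B)
    (s u t : Set.Icc (0 : ℝ) T) : (B s t).pair = convolution (B s u).pair (B u t).pair :=
  CK.linearMap_ext fun m => hB.chen s u t m le_top

theorem IsBranchedRoughPath.continuousAt_diagonal (hα : 0 < α) (hB : IsBranchedRoughPath α B)
    (t : Set.Icc (0 : ℝ) T) (h : CK A) : ContinuousAt (fun v => (B t v).pair h) t := by
  induction h using MvPolynomial.induction_on' with
  | add p q hp hq =>
    simp only [map_add]
    exact hp.add hq
  | monomial m c =>
    have e : (MvPolynomial.monomial m c : CK A) = c • forest m := by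
      rw [forest, MvPolynomial.smul_monomial, smul_eq_mul, mul_one]
    simp only [e, map_smul]
    refine ContinuousAt.const_smul ?_ c
    rcases eq_or_ne m 0 with rfl | hm
    · simp only [forest_zero, ButcherGroup.pair_one]
      exact continuousAt_const
    obtain ⟨C, hC⟩ := hB.holder m le_top
    have hpos : 0 < (α : ℝ) * forestDegree m :=
      mul_pos (by exact_mod_cast hα) (by exact_mod_cast forestDegree_pos hm)
    have h0 : (B t t).pair (forest m) = 0 := by
      have := hC t t
      rw [sub_self, abs_zero, Real.zero_rpow hpos.ne', mul_zero] at this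
      exact abs_nonpos_iff.1 this
    rw [ContinuousAt, h0]
    refine squeeze_zero_norm (hC t) ?_
    have hc : Continuous fun v : Set.Icc (0 : ℝ) T =>
        C * |(v : ℝ) - t| ^ ((α : ℝ) * forestDegree m) :=
      continuous_const.mul (((continuous_subtype_val.sub continuous_const).abs).rpow_const
        fun _ => Or.inr hpos.le)
    have := hc.tendsto t
    rwa [sub_self, abs_zero, Real.zero_rpow hpos.ne', mul_zero] at this

theorem IsBranchedRoughPath.continuous_right (hα : 0 < α) (hB : IsBranchedRoughPath α B)
    (s : Set.Icc (0 : ℝ) T) (h : CK A) : Continuous fun v => (B s v).pair h := by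
  refine continuous_iff_continuousAt.2 fun t => ?_
  have key : ∀ y : CK A ⊗[ℝ] CK A,
      ContinuousAt (fun v => tensorPair (B s t).pair (B t v).pair y) t := by
    intro y
    induction y using TensorProduct.induction_on with
    | zero => simpa using continuousAt_const
    | add y z hy hz =>
      simp only [map_add]
      exact hy.add hz
    | tmul u w => exact continuousAt_const.mul (hB.continuousAt_diagonal hα t w)
  have e : (fun v => (B s v).pair h) =
      fun v => tensorPair (B s t).pair (B t v).pair (coproduct h) := by
    ext1 v
    rw [hB.convolution_eq s t v]
    rfl
  rw [e]
  exact key (coproduct h)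

theorem IsBranchedRoughPath.continuous_tensorPair (hα : 0 < α) (hB : IsBranchedRoughPath α B)
    (f : CK A →ₗ[ℝ] ℝ) (s : Set.Icc (0 : ℝ) T) (y : CK A ⊗[ℝ] CK A) :
    Continuous fun v => tensorPair f (B s v).pair y := by
  induction y using TensorProduct.induction_on with
  | zero => simpa using continuous_const
  | add y z hy hz =>
    simp only [map_add]
    exact hy.add hz
  | tmul u w => exact continuous_const.mul (hB.continuous_right hα s w)

/-- Integration against time acts on the right factor of a tensor. -/
theorem IsBranchedRoughPath.integral_tensorPair (hT : 0 < T) (hα : 0 < α)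
    (hB : IsBranchedRoughPath α B) (f : CK A →ₗ[ℝ] ℝ) (a : A) (s t : Set.Icc (0 : ℝ) T) {n : ℕ}
    (h : ∀ m, forestDegree m < n → (B s t).pair (graftLin a (forest m)) =
      ∫ v in (s : ℝ)..(t : ℝ), (B s (Set.projIcc 0 T hT.le v)).pair (forest m))
    {y : CK A ⊗[ℝ] CK A} (hy : y ∈ reducedSpan A n) :
    ∫ v in (s : ℝ)..(t : ℝ), tensorPair f (B s (Set.projIcc 0 T hT.le v)).pair y =
      tensorPair f ((B s t).pair ∘ₗ graftLin a) y := by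
  induction hy using Submodule.span_induction with
  | zero => simp
  | add y z _ _ hy hz =>
    simp only [map_add]
    rw [intervalIntegral.integral_add, hy, hz] <;>
    exact ((hB.continuous_tensorPair hα f s _).comp continuous_projIcc).intervalIntegrable _ _
  | smul c y _ hy =>
    simp only [map_smul, smul_eq_mul]
    rw [intervalIntegral.integral_const_mul, hy]
  | mem y hy =>
    obtain ⟨b, c, hb, hc, hbc, rfl⟩ := hy
    have := forestDegree_pos hb
    simp only [tensorPair_tmul, LinearMap.comp_apply]
    rw [intervalIntegral.integral_const_mul, h c (by omega)]

end Continuity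

variable {d p : ℕ} {T : ℝ} {hT : 0 < T} {α : ℝ≥0}
  {x : C(Set.Icc (0 : ℝ) T, ButcherGroup (Fin (d + 1)) p)}
  {X : Set.Icc (0 : ℝ) T → EuclideanSpace ℝ (Fin d)}
  {B : Set.Icc (0 : ℝ) T → Set.Icc (0 : ℝ) T → ButcherGroup (Fin (d + 1)) ⊤}
  {Z : Set.Icc (0 : ℝ) T → Set.Icc (0 : ℝ) T → ButcherGroup (Fin (d + 1)) p}

/-- The integrals of order larger than one of a full rough path against time are the classical
ones, as soon as this holds in lower degree: both solve the same Chen relation. -/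
theorem IsBranchedRoughPath.pair_graftLin_of_lower (hα0 : 0 < α) (hα1 : α ≤ 1)
    (hB : IsBranchedRoughPath α B) (m : Tree (Fin (d + 1)) →₀ ℕ) (hm : m ≠ 0)
    (hα : 1 < (α : ℝ) * (forestDegree m + 1 : ℕ))
    (ih : ∀ k, forestDegree k < forestDegree m → ∀ s t, (B s t).pair (graftLin 0 (forest k)) =
      ∫ v in (s : ℝ)..(t : ℝ), (B s (Set.projIcc 0 T hT.le v)).pair (forest k))
    (s t : Set.Icc (0 : ℝ) T) : (B s t).pair (graftLin 0 (forest m)) =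
      ∫ v in (s : ℝ)..(t : ℝ), (B s (Set.projIcc 0 T hT.le v)).pair (forest m) := by
  obtain ⟨C, hC⟩ := hB.holder (Finsupp.single (Tree.graft 0 (Finsupp.toMultiset m)) 1) le_top
  obtain ⟨D', hD'⟩ := hB.holder m le_top
  obtain ⟨D, hD0, hD⟩ : ∃ D : ℝ, 0 ≤ D ∧ ∀ s t : Set.Icc (0 : ℝ) T,
      |(B s t).pair (forest m)| ≤ D * |(t : ℝ) - s| ^ ((α : ℝ) * forestDegree m) :=
    ⟨|D'|, abs_nonneg _, fun s t => (hD' s t).trans (by gcongr; exact le_abs_self _)⟩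
  have hint : ∀ (f : Set.Icc (0 : ℝ) T → ℝ), Continuous f → ∀ a b : ℝ,
      IntervalIntegrable (fun v => f (Set.projIcc 0 T hT.le v)) MeasureTheory.volume a b :=
    fun f hf a b => (hf.comp continuous_projIcc).intervalIntegrable a b
  refine sub_eq_zero.1 (eq_zero_of_additive hα
    (D := fun s t => (B s t).pair (graftLin 0 (forest m)) -
      ∫ v in (s : ℝ)..(t : ℝ), (B s (Set.projIcc 0 T hT.le v)).pair (forest m))
    (C := C + D * T ^ (1 - (α : ℝ))) (fun s u t => ?_) (fun s t => ?_) s t)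
  · have hred := reducedCoproduct_mem m hm
    have h1 : (B s t).pair (graftLin 0 (forest m)) = (B s u).pair (graftLin 0 (forest m)) +
        (tensorPair (B s u).pair ((B u t).pair ∘ₗ graftLin 0) (reducedCoproduct m) +
          (B s u).pair (forest m) * (B u t).pair (graftLin 0 (forest 0)) +
          (B u t).pair (graftLin 0 (forest m))) := by
      rw [hB.convolution_eq s u t, convolution_graftLin, (B u t).pair_one, mul_one,
        convolution_apply, coproduct_forest, map_add, map_add, tensorPair_tmul, tensorPair_tmul,
        (B s u).pair_one, one_mul, forest_zero]
      rfl
    have h2 : ∀ v, (B s v).pair (forest m) =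
        tensorPair (B s u).pair (B u v).pair (reducedCoproduct m) + (B s u).pair (forest m) +
          (B u v).pair (forest m) := by
      intro v
      rw [hB.convolution_eq s u v, convolution_forest _ _ (B s u).pair_one (B u v).pair_one]
      ring
    have h3 : ∫ v in (u : ℝ)..(t : ℝ), (B s (Set.projIcc 0 T hT.le v)).pair (forest m) =
        tensorPair (B s u).pair ((B u t).pair ∘ₗ graftLin 0) (reducedCoproduct m) +
          (B s u).pair (forest m) * (B u t).pair (graftLin 0 (forest 0)) +
          ∫ v in (u : ℝ)..(t : ℝ), (B u (Set.projIcc 0 T hT.le v)).pair (forest m) := by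
      have h4 := ih 0 (by simpa using forestDegree_pos hm) u t
      simp only [forest_zero, ButcherGroup.pair_one] at h4
      rw [intervalIntegral.integral_congr fun v _ => h2 (Set.projIcc 0 T hT.le v),
        intervalIntegral.integral_add, intervalIntegral.integral_add,
        hB.integral_tensorPair hT hα0 _ 0 u t (fun k hk => ih k hk u t) hred, forest_zero, h4]
      · simp [mul_comm]
      · exact hint _ (hB.continuous_tensorPair hα0 _ u _) _ _
      · exact intervalIntegrable_const
      · exact (hint _ (hB.continuous_tensorPair hα0 _ u _) _ _).add intervalIntegrable_const
      · exact hint _ (hB.continuous_right hα0 u _) _ _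
    have h5 := intervalIntegral.integral_add_adjacent_intervals
      (hint _ (hB.continuous_right hα0 s (forest m)) s u)
      (hint _ (hB.continuous_right hα0 s (forest m)) u t)
    rw [← h5, h1, h3]
    ring
  · have h1 := hC s t
    rw [forestDegree_single, degree_graft_toMultiset, forest_single, ← graftLin_forest] at h1
    have h2 : |∫ v in (s : ℝ)..(t : ℝ), (B s (Set.projIcc 0 T hT.le v)).pair (forest m)| ≤
        D * |(t : ℝ) - s| ^ ((α : ℝ) * forestDegree m) * |(t : ℝ) - s| := by
      rw [← Real.norm_eq_abs]
      refine intervalIntegral.norm_integral_le_of_norm_le_const fun v hv => ?_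
      have h3 : |(Set.projIcc 0 T hT.le v : ℝ) - Set.projIcc 0 T hT.le s| ≤ |v - s| :=
        Set.abs_projIcc_sub_projIcc hT.le
      rw [Set.projIcc_val] at h3
      replace h3 := h3.trans (Set.abs_sub_left_of_mem_uIcc (Set.uIoc_subset_uIcc hv))
      exact (hD s _).trans (mul_le_mul_of_nonneg_left
        (Real.rpow_le_rpow (abs_nonneg _) h3 (by positivity)) hD0)
    have h3 : |(t : ℝ) - s| ≤ T := by
      rw [abs_le]
      constructor <;> linarith [s.2.1, s.2.2, t.2.1, t.2.2]
    have hα1' : (α : ℝ) ≤ 1 := by exact_mod_cast hα1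
    have h4 : |(t : ℝ) - s| ≤ T ^ (1 - (α : ℝ)) * |(t : ℝ) - s| ^ (α : ℝ) := by
      calc |(t : ℝ) - s| = |(t : ℝ) - s| ^ (1 - (α : ℝ)) * |(t : ℝ) - s| ^ (α : ℝ) := by
            rw [← Real.rpow_add_of_nonneg (abs_nonneg _) (by linarith) (by positivity),
              sub_add_cancel, Real.rpow_one]
        _ ≤ _ := by gcongr
    have h5 : |(t : ℝ) - s| ^ ((α : ℝ) * (forestDegree m + 1 : ℕ)) =
        |(t : ℝ) - s| ^ ((α : ℝ) * forestDegree m) * |(t : ℝ) - s| ^ (α : ℝ) := by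
      rw [← Real.rpow_add_of_nonneg (abs_nonneg _) (by positivity) (by positivity)]
      push_cast
      ring_nf
    refine (abs_sub _ _).trans ((add_le_add h1 h2).trans ?_)
    rw [add_mul]
    refine add_le_add le_rfl ?_
    calc _ ≤ D * |(t : ℝ) - s| ^ ((α : ℝ) * forestDegree m) *
          (T ^ (1 - (α : ℝ)) * |(t : ℝ) - s| ^ (α : ℝ)) := by gcongr
      _ = _ := by rw [h5]; ring

/-- The time integrals in the branched signature of a lift of a time-extended path are the classical
ones, in all degrees. -/
theorem IsBranchedSignature.pair_graftLin (hα0 : 0 < α) (hα1 : α ≤ 1) (hp : 1 ≤ p)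
    (hα : 1 < (α : ℝ) * (p + 1 : ℕ)) (hB : IsBranchedSignature hT α x B)
    (hZ : IsTimeExtendedLift hT α X Z) (hx : ∀ t, x t = Z ⟨0, Set.left_mem_Icc.2 hT.le⟩ t)
    (m : Tree (Fin (d + 1)) →₀ ℕ) (s t : Set.Icc (0 : ℝ) T) :
    (B s t).pair (graftLin 0 (forest m)) =
      ∫ v in (s : ℝ)..(t : ℝ), (B s (Set.projIcc 0 T hT.le v)).pair (forest m) := by
  induction hk : forestDegree m using Nat.strong_induction_on generalizing m s t with
  | _ k ih =>
    rcases Nat.lt_or_ge p (forestDegree m + 1) with hm | hm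
    · refine hB.isBranchedRoughPath.pair_graftLin_of_lower (hT := hT) hα0 hα1 m ?_
        (hα.trans_le (by gcongr; omega)) (fun k hk' s t => ih _ (by omega) k s t rfl) s t
      rintro rfl
      simp at hm
      omega
    · have e := hB.pair_forest_eq hZ.isBranchedRoughPath hx
      have h := hZ.time_integral s t m (by exact_mod_cast hm)
      rw [graftLin_forest, ← forest_single] at h ⊢
      rw [e _ (by rwa [forestDegree_single, degree_graft_toMultiset]), h]
      simp only [e m (by omega)]

/-- The moments of the coordinates of a path are coordinates of its branched signature. -/
theorem IsBranchedSignature.pair_moment (hα0 : 0 < α) (hα1 : α ≤ 1) (hp : 1 ≤ p)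
    (hα : 1 < (α : ℝ) * (p + 1 : ℕ)) (hB : IsBranchedSignature hT α x B)
    (hZ : IsTimeExtendedLift hT α X Z) (hx : ∀ t, x t = Z ⟨0, Set.left_mem_Icc.2 hT.le⟩ t)
    (m : Tree (Fin (d + 1)) →₀ ℕ) (hm : forestDegree m ≤ p) (k : ℕ) :
    (B ⟨0, Set.left_mem_Icc.2 hT.le⟩ ⟨T, Set.right_mem_Icc.2 hT.le⟩).pair
        (graftLin 0 (forest (m + Finsupp.single (Tree.single 0) k))) =
      ∫ v in (0 : ℝ)..T, (x (Set.projIcc 0 T hT.le v)).pair (forest m) *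
        (Set.projIcc 0 T hT.le v : ℝ) ^ k := by
  have htime : ∀ t, (B ⟨0, Set.left_mem_Icc.2 hT.le⟩ t).pair (MvPolynomial.X (Tree.single 0)) =
      (t : ℝ) := by
    intro t
    have h := hB.pair_graftLin hα0 hα1 hp hα hZ hx 0 ⟨0, Set.left_mem_Icc.2 hT.le⟩ t
    rw [graftLin_forest, map_zero] at h
    simp only [forest_zero, ButcherGroup.pair_one] at h
    refine h.trans ?_
    simp
  rw [hB.pair_graftLin hα0 hα1 hp hα hZ hx]
  refine intervalIntegral.integral_congr fun v _ => ?_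
  have e : forest (Finsupp.single (Tree.single 0) k) =
      (MvPolynomial.X (Tree.single 0) : CK (Fin (d + 1))) ^ k := MvPolynomial.X_pow_eq_monomial.symm
  rw [← hB.extends_path _ m hm, ← htime, forest_add, e, ButcherGroup.pair_eq_characterLin,
    characterLin_mul]
  congr 1
  exact map_pow (character _) _ _

end TimeIntegral

section Approximation

/-! ### Approximation -/

theorem ButcherGroup.continuous_pair_forest {A : Type*} {N : ℕ∞} (m : Tree A →₀ ℕ) :
    Continuous fun g : ButcherGroup A N => g.pair (forest m) := by
  have h : Continuous fun (g : ButcherGroup A N) (m : Tree A →₀ ℕ) => g.pair (forest m) :=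
    continuous_induced_dom
  exact (continuous_apply m).comp h

/-- A continuous function on an interval is determined by its moments. -/
theorem eq_zero_of_moments {T : ℝ} (hT : 0 < T) (g : C(Set.Icc (0 : ℝ) T, ℝ))
    (h : ∀ k : ℕ, ∫ v in (0 : ℝ)..T, g (Set.projIcc 0 T hT.le v) *
      (Set.projIcc 0 T hT.le v : ℝ) ^ k = 0) : g = 0 := by
  set L : C(Set.Icc (0 : ℝ) T, ℝ) → ℝ := fun q =>
    ∫ v in (0 : ℝ)..T, g (Set.projIcc 0 T hT.le v) * q (Set.projIcc 0 T hT.le v) with hL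
  have hLcont : Continuous L := by
    refine intervalIntegral.continuous_parametric_intervalIntegral_of_continuous' ?_ _ _
    have hp : Continuous (Set.projIcc 0 T hT.le) := continuous_projIcc
    exact (g.continuous.comp (hp.comp continuous_snd)).mul
      (continuous_eval.comp (continuous_fst.prodMk (hp.comp continuous_snd)))
  have hpoly : ∀ q ∈ (polynomialFunctions (Set.Icc 0 T) : Set C(Set.Icc (0 : ℝ) T, ℝ)),
      q ∈ L ⁻¹' {0} := by
    rintro _ ⟨q, -, rfl⟩
    simp only [hL, Set.mem_preimage, Set.mem_singleton_iff]
    induction q using Polynomial.induction_on' with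
    | add p q hp hq =>
      simp only [map_add, ContinuousMap.add_apply, mul_add]
      rw [intervalIntegral.integral_add, hp, hq, add_zero] <;>
      exact ((g.continuous.mul (ContinuousMap.continuous _)).comp
        continuous_projIcc).intervalIntegrable _ _
    | monomial k c =>
      have e : ∀ v, g (Set.projIcc 0 T hT.le v) *
          (Polynomial.toContinuousMapOnAlgHom (Set.Icc 0 T) (Polynomial.monomial k c))
            (Set.projIcc 0 T hT.le v) =
          c * (g (Set.projIcc 0 T hT.le v) * (Set.projIcc 0 T hT.le v : ℝ) ^ k) := by
        intro v
        simp
        ring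
      simp only [RingHom.coe_coe, e]
      rw [intervalIntegral.integral_const_mul, h k, mul_zero]
  have hall : L g = 0 := by
    have hmem : g ∈ (polynomialFunctions (Set.Icc 0 T)).topologicalClosure := by
      rw [polynomialFunctions_closure_eq_top]
      exact Algebra.mem_top
    exact (isClosed_singleton.preimage hLcont).closure_subset_iff.2 hpoly hmem
  by_contra hg
  obtain ⟨t, ht⟩ : ∃ t, g t ≠ 0 := by
    by_contra! h0
    exact hg (ContinuousMap.ext h0)
  refine hall.not_gt (intervalIntegral.integral_pos hT ?_ (fun v _ => mul_self_nonneg _)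
    ⟨t, t.2, ?_⟩)
  · exact ((g.continuous.mul g.continuous).comp continuous_projIcc).continuousOn
  · rw [Set.projIcc_val]
    exact mul_self_pos.2 ht

variable {d p : ℕ} {T : ℝ} (hT : 0 < T) (α : ℝ≥0)
  (H : Set C(Set.Icc (0 : ℝ) T, ButcherGroup (Fin (d + 1)) p))

/-- The algebra of the continuous functions on a set of paths which are linear functionals of the
branched signature at the final time. -/
def signatureAlgebra : Subalgebra ℝ C(H, ℝ) where
  carrier := {φ | ∃ h : CK (Fin (d + 1)), ∀ (x : H)
    (B : Set.Icc (0 : ℝ) T → Set.Icc (0 : ℝ) T → ButcherGroup (Fin (d + 1)) ⊤),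
    IsBranchedSignature hT α x.1 B →
      φ x = (B ⟨0, Set.left_mem_Icc.2 hT.le⟩ ⟨T, Set.right_mem_Icc.2 hT.le⟩).pair h}
  mul_mem' := by
    rintro φ ψ ⟨h, hφ⟩ ⟨k, hψ⟩
    refine ⟨h * k, fun x B hB => ?_⟩
    rw [ContinuousMap.mul_apply, hφ x B hB, hψ x B hB, ButcherGroup.pair_eq_characterLin,
      characterLin_mul]
  add_mem' := by
    rintro φ ψ ⟨h, hφ⟩ ⟨k, hψ⟩
    refine ⟨h + k, fun x B hB => ?_⟩
    rw [ContinuousMap.add_apply, hφ x B hB, hψ x B hB, map_add]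
  algebraMap_mem' c := by
    refine ⟨c • 1, fun x B hB => ?_⟩
    rw [map_smul, ButcherGroup.pair_one]
    simp

/-- The moments `∫₀ᵀ ⟨x_v, m⟩ vᵏ dv` of a path. -/
def moment (m : Tree (Fin (d + 1)) →₀ ℕ) (k : ℕ) : C(H, ℝ) where
  toFun x := ∫ v in (0 : ℝ)..T, (x.1 (Set.projIcc 0 T hT.le v)).pair (forest m) *
    (Set.projIcc 0 T hT.le v : ℝ) ^ k
  continuous_toFun := by
    set e : C(ButcherGroup (Fin (d + 1)) p, ℝ) := ⟨_, ButcherGroup.continuous_pair_forest m⟩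
    have hL : Continuous fun g : C(Set.Icc (0 : ℝ) T, ℝ) =>
        ∫ v in (0 : ℝ)..T, g (Set.projIcc 0 T hT.le v) * (Set.projIcc 0 T hT.le v : ℝ) ^ k := by
      refine intervalIntegral.continuous_parametric_intervalIntegral_of_continuous' ?_ _ _
      have hp : Continuous (Set.projIcc 0 T hT.le) := continuous_projIcc
      exact (continuous_eval.comp (continuous_fst.prodMk (hp.comp continuous_snd))).mul
        ((continuous_subtype_val.comp (hp.comp continuous_snd)).pow k)
    exact hL.comp ((ContinuousMap.continuous_postcomp e).comp continuous_subtype_val)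

variable {hT α H}

theorem moment_mem_signatureAlgebra (hα0 : 0 < α) (hα1 : α ≤ 1) (hp : 1 ≤ p)
    (hα : 1 < (α : ℝ) * (p + 1 : ℕ)) (hH : H ⊆ liftPaths d hT α p)
    (m : Tree (Fin (d + 1)) →₀ ℕ) (hm : forestDegree m ≤ p) (k : ℕ) :
    moment hT H m k ∈ signatureAlgebra hT α H := by
  refine ⟨graftLin 0 (forest (m + Finsupp.single (Tree.single 0) k)), fun x B hB => ?_⟩
  obtain ⟨X, Z, -, hZ, hx⟩ := hH x.2
  exact (hB.pair_moment hα0 hα1 hp hα hZ hx m hm k).symm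

theorem signatureAlgebra_separatesPoints (hα0 : 0 < α) (hα1 : α ≤ 1) (hp : 1 ≤ p)
    (hα : 1 < (α : ℝ) * (p + 1 : ℕ)) (hH : H ⊆ liftPaths d hT α p) :
    (signatureAlgebra hT α H).SeparatesPoints := by
  intro x y hxy
  by_contra hsep
  refine hxy (Subtype.ext (ContinuousMap.ext fun t => ButcherGroup.ext
    (CK.linearMap_ext fun m => ?_)))
  rcases le_or_gt (forestDegree m) p with hm | hm
  · set e : C(ButcherGroup (Fin (d + 1)) p, ℝ) := ⟨_, ButcherGroup.continuous_pair_forest m⟩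
    have h0 : e.comp x.1 - e.comp y.1 = 0 := by
      refine eq_zero_of_moments hT _ fun k => ?_
      have hk : moment hT H m k x = moment hT H m k y := by
        by_contra hne
        exact hsep ⟨_, ⟨_, moment_mem_signatureAlgebra hα0 hα1 hp hα hH m hm k, rfl⟩, hne⟩
      have hint : ∀ z : C(Set.Icc (0 : ℝ) T, ButcherGroup (Fin (d + 1)) p), IntervalIntegrable
          (fun v => (z (Set.projIcc 0 T hT.le v)).pair (forest m) *
            (Set.projIcc 0 T hT.le v : ℝ) ^ k) MeasureTheory.volume 0 T := fun z =>
        (((e.comp z).continuous.mul (continuous_subtype_val.pow k)).comp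
          continuous_projIcc).intervalIntegrable _ _
      calc _ = ∫ v in (0 : ℝ)..T, ((x.1 (Set.projIcc 0 T hT.le v)).pair (forest m) *
            (Set.projIcc 0 T hT.le v : ℝ) ^ k - (y.1 (Set.projIcc 0 T hT.le v)).pair (forest m) *
            (Set.projIcc 0 T hT.le v : ℝ) ^ k) :=
          intervalIntegral.integral_congr fun v _ => sub_mul _ _ _
        _ = moment hT H m k x - moment hT H m k y :=
          intervalIntegral.integral_sub (hint x.1) (hint y.1)
        _ = 0 := sub_eq_zero.2 hk
    exact sub_eq_zero.1 (DFunLike.congr_fun h0 t)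
  · rw [(x.1 t).pair_eq_zero m (by exact_mod_cast hm),
      (y.1 t).pair_eq_zero m (by exact_mod_cast hm)]

end Approximation

end BranchedSig

end

theorem mainTheorem1 (d : ℕ) (T : ℝ) (hT : 0 < T) (α : ℝ≥0) (hα : 1 / 4 < α) (hα1 : α ≤ 1)
    (p : ℕ) (hp : p = ⌊1 / α⌋₊)
    (H : Set C(Set.Icc (0 : ℝ) T, BranchedSig.ButcherGroup (Fin (d + 1)) p))
    (hH : H ⊆ BranchedSig.liftPaths d hT α p) (hHc : IsCompact H) (f : C(H, ℝ)) :
    (∀ x ∈ H, ∃! B : Set.Icc (0 : ℝ) T → Set.Icc (0 : ℝ) T →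
        BranchedSig.ButcherGroup (Fin (d + 1)) ⊤, BranchedSig.IsBranchedSignature hT α x B) ∧
    ∀ ε : ℝ, 0 < ε → ∃ h : BranchedSig.CK (Fin (d + 1)), ∃ δ < ε, ∀ (x : H)
      (B : Set.Icc (0 : ℝ) T → Set.Icc (0 : ℝ) T → BranchedSig.ButcherGroup (Fin (d + 1)) ⊤),
      BranchedSig.IsBranchedSignature hT α x.1 B →
        |f x - (B ⟨0, Set.left_mem_Icc.2 hT.le⟩ ⟨T, Set.right_mem_Icc.2 hT.le⟩).pair h| ≤ δ := by
  have hα0 : 0 < α := lt_trans (by positivity) hα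
  have hp1 : 1 ≤ p := by
    rw [hp]
    exact Nat.le_floor (by rw [Nat.cast_one]; exact (one_le_div hα0).2 hα1)
  have hαp : 1 < (α : ℝ) * (p + 1 : ℕ) := by
    have h : 1 / α < (p + 1 : ℕ) := by
      rw [hp]
      push_cast
      exact Nat.lt_floor_add_one _
    rw [div_lt_iff₀ hα0, mul_comm] at h
    exact_mod_cast h
  refine ⟨fun x hx => ?_, fun ε hε => ?_⟩
  · obtain ⟨X, Z, -, hZ, hxZ⟩ := hH hx
    exact BranchedSig.existsUnique_isBranchedSignature hαp hZ.isBranchedRoughPath hxZ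
  · have : CompactSpace H := isCompact_iff_compactSpace.1 hHc
    obtain ⟨⟨φ, h, hφ⟩, hfφ⟩ :=
      ContinuousMap.exists_mem_subalgebra_near_continuousMap_of_separatesPoints _
        (BranchedSig.signatureAlgebra_separatesPoints hα0 hα1 hp1 hαp hH) f (ε / 2) (by linarith)
    refine ⟨h, ε / 2, by linarith, fun x B hB => ?_⟩
    rw [← hφ x B hB, abs_sub_comm]
    exact (ContinuousMap.norm_coe_le_norm (φ - f) x).trans hfφ.le
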